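/- **Conventions.** Let $\mathcal C$ be a small additive category, $\mathbb E\colon \mathcal C^{op}\times\mathcal C\to\mathrm{Ab}$ a biadditive functor, and write $a_*\delta=\mathbb E(C,a)(\delta)$, $c^*\delta=\mathbb E(c,A)(\delta)$ for $\delta\in\mathbb E(C,A)$. Two sequences $A\to B\to C$ and $A\to B'\to C$ are equivalent if there is an isomorphism $B\cong B'$ compatible with the maps from $A$ and to $C$. Let $\mathfrak s$ assign to every $\delta\in\mathbb E(C,A)$ an equivalence class $\mathfrak s(\delta)=[A\to B\to C]$. An *$\mathfrak s$-triangle* $\langle A\xrightarrow{x}B\xrightarrow{y}C,\delta\rangle$ is a sequence with an extension $\delta\in\mathbb E(C,A)$ such that $\mathfrak s(\delta)=[A\xrightarrow{x}B\xrightarrow{y}C]$; then $x$ is called an $\mathfrak s$-inflation and $y$ an $\mathfrak s$-deflation. A morphism of $\mathfrak s$-triangles $\langle x,y,\delta\rangle\to\langle x',y',\delta'\rangle$ is a triple $(a,b,c)$ with $bx=x'a$, $cy=y'b$, $a_*\delta=c^*\delta'$. The triple $(\mathcal C,\mathbb E,\mathfrak s)$ is *weakly extriangulated* if: * (C1) for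 every $\mathfrak s$-triangle and every $X$ the sequence $\mathcal C(X,A)\xrightarrow{x\circ-}\mathcal C(X,B)\xrightarrow{y\circ-}\mathcal C(X,C)\xrightarrow{f\mapsto f^*\delta}\mathbb E(X,A)$ is exact; * (C1') for every $\mathfrak s$-triangle and every $X$ the sequence $\mathcal C(C,X)\xrightarrow{-\circ y}\mathcal C(B,X)\xrightarrow{-\circ x}\mathcal C(A,X)\xrightarrow{g\mapsto g_*\delta}\mathbb E(C,X)$ is exact; * (C2), (C2') $\mathfrak s(0)=[A\xrightarrow{\mathrm{id}}A\to0]$ for $0\in\mathbb E(0,A)$, and $\mathfrak s(0)=[0\to A\xrightarrow{\mathrm{id}}A]$ for $0\in\mathbb E(A,0)$; * (C3) for all $\mathfrak s$-triangles $\langle A\xrightarrow{x}B\xrightarrow{y}C,\delta\rangle$ and $\langle A'\xrightarrow{x'}B'\xrightarrow{y'}C,a_*\delta\rangle$ with $a\in\mathcal C(A,A')$ there is $b$ such that $(a,b,\mathrm{id}_C)$ is a morphism of $\mathfrak s$-triangles and $\langle A\xrightarrow{\left[\begin{smallmatrix}x\\a\end{smallmatrix}\right]}B\oplus A'\xrightarrow{[b\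 -x']}B',y'^*\delta\rangle$ is an $\mathfrak s$-triangle; * (C3') for all $\mathfrak s$-triangles $\langle A\xrightarrow{x}B\xrightarrow{y}C,\delta\rangle$ and $\langle A\xrightarrow{x'}B'\xrightarrow{y'}C',c^*\delta\rangle$ with $c\in\mathcal C(C',C)$ there is $b$ such that $(\mathrm{id}_A,b,c)$ is a morphism of $\mathfrak s$-triangles from the second to the first and $\langle B'\xrightarrow{\left[\begin{smallmatrix}-y'\\b\end{smallmatrix}\right]}C'\oplus B\xrightarrow{[c\ y]}C,x'_*\delta\rangle$ is an $\mathfrak s$-triangle. It is *extriangulated* if moreover $\mathfrak s$-inflations and $\mathfrak s$-deflations are each closed under composition. An *exact functor* $(F,\phi)\colon(\mathcal C,\mathbb E,\mathfrak s)\to(\mathcal D,\mathbb F,\mathfrak t)$ is an additive functor $F$ with a natural transformation $\phi\colon\mathbb E\Rightarrow\mathbb F\circ(F^{op}\times F)$ such that $\langle F(x),F(y),\phi(\delta)\rangle$ is a $\mathfrak t$-triangle for every $\mathfrak s$-triangle $\langle x,y,\delta\rangle$; exact functors compose by $(F',\phi')\circ(F,\phi)=(F'\circ F,(\phi'\circ(F^{op}\times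 F))\cdot\phi)$. A *natural transformation of exact functors* $(F,\phi)\Rightarrow(G,\psi)$ is a natural transformation $\eta\colon F\Rightarrow G$ with $(\eta_A)_*\phi_{C,A}(\delta)=(\eta_C)^*\psi_{C,A}(\delta)$ for all $\delta\in\mathbb E(C,A)$. **Statement.** Let $(\mathcal C,\mathbb E,\mathfrak s)$ be an extriangulated category with $\mathcal C$ small, and let $\mathcal S$ be a class of morphisms of $\mathcal C$ satisfying * (M0) $\mathcal S$ contains all isomorphisms and is closed under composition and finite direct sums of morphisms. Let $\mathcal N_{\mathcal S}$ be the full subcategory of the objects $N$ such that both $N\to0$ and $0\to N$ belong to $\mathcal S$, let $p\colon\mathcal C\to\overline{\mathcal C}=\mathcal C/[\mathcal N_{\mathcal S}]$ be the ideal quotient, and let $\overline{\mathcal S}$ be the closure of $p(\mathcal S)$ under composition with isomorphisms of $\overline{\mathcal C}$. Assume $p(\mathcal S)=\overline{\mathcal S}$. Assume also: * (M1) $\mathcal S$ satisfies 2-out-of-3 with respect to composition. * (M2) $\mathcal S$ is a multiplicative system in $\mathcal C$ (left and right calculus of fractions). * (M3) For all $\mathfrak s$-triangles $\langle A\xrightarrow{x}B\xrightarrow{y}C,\delta\rangle$,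 $\langle A'\xrightarrow{x'}B'\xrightarrow{y'}C',\delta'\rangle$ and all $a\in\mathcal C(A,A')$, $c\in\mathcal C(C,C')$ in $\mathcal S$ with $a_*\delta=c^*\delta'$ there is $b\in\mathcal S$ such that $(a,b,c)$ is a morphism of $\mathfrak s$-triangles. Let $Q\colon\mathcal C\to\widetilde{\mathcal C}$ be the localization of $\mathcal C$ by $\mathcal S$. Then $\widetilde{\mathcal C}$ is additive, and there are a biadditive functor $\widetilde{\mathbb E}\colon\widetilde{\mathcal C}^{op}\times\widetilde{\mathcal C}\to\mathrm{Ab}$, a map $\widetilde{\mathfrak s}$ and a natural transformation $\mu\colon\mathbb E\Rightarrow\widetilde{\mathbb E}\circ(Q^{op}\times Q)$ such that: 1. $(\widetilde{\mathcal C},\widetilde{\mathbb E},\widetilde{\mathfrak s})$ is weakly extriangulated and $(Q,\mu)\colon(\mathcal C,\mathbb E,\mathfrak s)\to(\widetilde{\mathcal C},\widetilde{\mathbb E},\widetilde{\mathfrak s})$ is an exact functor. 2. For every weakly extriangulated category $(\mathcal D,\mathbb F,\mathfrak t)$: (i) for every exact functor $(F,\phi)\colon(\mathcal C,\mathbb E,\mathfrak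 s)\to(\mathcal D,\mathbb F,\mathfrak t)$ such that $F(s)$ is an isomorphism for all $s\in\mathcal S$, there is a unique exact functor $(\widetilde F,\widetilde\phi)\colon(\widetilde{\mathcal C},\widetilde{\mathbb E},\widetilde{\mathfrak s})\to(\mathcal D,\mathbb F,\mathfrak t)$ with $(F,\phi)=(\widetilde F,\widetilde\phi)\circ(Q,\mu)$; (ii) for any two such $(F,\phi),(G,\psi)$, with $(\widetilde F,\widetilde\phi),(\widetilde G,\widetilde\psi)$ as in (i), and every natural transformation $\eta\colon(F,\phi)\Rightarrow(G,\psi)$ of exact functors, there is a unique natural transformation $\widetilde\eta\colon(\widetilde F,\widetilde\phi)\Rightarrow(\widetilde G,\widetilde\psi)$ of exact functors with $\eta=\widetilde\eta\circ(Q,\mu)$. 3. If moreover (M4) the class $\{t\circ x\circ s\mid x\text{ an }\mathfrak s\text{-inflation},\ s,t\in\mathcal S\}$ and the class $\{t\circ y\circ s\mid y\text{ an }\mathfrak s\text{-deflation},\ s,t\in\mathcal S\}$ are both closed under composition, then $(\widetilde{\mathcal C},\widetilde{\mathbb E},\widetilde{\mathfrak s})$ is extriangulated. -/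

import Mathlib

open CategoryTheory CategoryTheory.Limits Opposite

open scoped ZeroObject

universe w w' w'' v v' v'' u u' u''

/-- A sequence `A ⟶ B ⟶ C` with prescribed outer terms. -/
structure ShortSeq {C : Type u} [Category.{v} C] (A Z : C) where
  /-- the middle term -/
  mid : C
  /-- the first map -/
  inc : A ⟶ mid
  /-- the second map -/
  proj : mid ⟶ Z

/-- Equivalence of sequences: an isomorphism of the middle terms compatible with the maps from the
first term and to the last term. -/
instance ShortSeq.setoid {C : Type u} [Category.{v} C] (A Z : C) : Setoid (ShortSeq A Z) where
  r σ τ := ∃ b : σ.mid ≅ τ.mid, σ.inc ≫ b.hom = τ.inc ∧ b.hom ≫ τ.proj = σ.proj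
  iseqv :=
    { refl := fun _ => ⟨Iso.refl _, by simp, by simp⟩
      symm := fun ⟨b, h₁, h₂⟩ => ⟨b.symm, by simp [← h₁], by simp [← h₂]⟩
      trans := fun ⟨b, h₁, h₂⟩ ⟨c, k₁, k₂⟩ =>
        ⟨b ≪≫ c, by simp [← k₁, ← h₁], by simp [← h₂, ← k₂]⟩ }

/-- A biadditive functor `E : Cᵒᵖ × C ⥤ Ab` (in curried form), together with a map `s` assigning to
each element `δ` of `E(Z, A)` an equivalence class of sequences `A ⟶ B ⟶ Z`. -/
structure ExtTriple (C : Type u) [Category.{v} C] [Preadditive C] where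
  /-- the functor of extensions -/
  E : Cᵒᵖ ⥤ C ⥤ AddCommGrpCat.{w}
  /-- additivity in the contravariant variable -/
  additive_left : E.Additive
  /-- additivity in the covariant variable -/
  additive_right : ∀ Z : C, (E.obj (op Z)).Additive
  /-- the realization -/
  s : ∀ {Z A : C}, (E.obj (op Z)).obj A → _root_.Quotient (ShortSeq.setoid A Z)

namespace ExtTriple

variable {C : Type u} [Category.{v} C] [Preadditive C] (T : ExtTriple.{w} C)

/-- The abelian group `E(Z, A)` of extensions. -/
abbrev Ext (Z A : C) : Type w := (T.E.obj (op Z)).obj A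

/-- `a_* : E(Z, A) → E(Z, A')`. -/
def push (Z : C) {A A' : C} (a : A ⟶ A') : T.Ext Z A →+ T.Ext Z A' :=
  ((T.E.obj (op Z)).map a).hom

/-- `c^* : E(Z, A) → E(Z', A)`. -/
def pull {Z' Z : C} (c : Z' ⟶ Z) (A : C) : T.Ext Z A →+ T.Ext Z' A :=
  ((T.E.map c.op).app A).hom

/-- `A ⟶ B ⟶ Z` together with `δ ∈ E(Z, A)` is an `s`-triangle: `s(δ) = [A ⟶ B ⟶ Z]`. -/
def IsTriangle {A B Z : C} (x : A ⟶ B) (y : B ⟶ Z) (δ : T.Ext Z A) : Prop :=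
  T.s δ = _root_.Quotient.mk (ShortSeq.setoid A Z) ⟨B, x, y⟩

/-- `s`-inflations: the first maps of `s`-conflations. -/
def inflations : MorphismProperty C := fun A B x =>
  ∃ (Z : C) (y : B ⟶ Z) (δ : T.Ext Z A), T.IsTriangle x y δ

/-- `s`-deflations: the second maps of `s`-conflations. -/
def deflations : MorphismProperty C := fun B Z y =>
  ∃ (A : C) (x : A ⟶ B) (δ : T.Ext Z A), T.IsTriangle x y δ

/-- `(a, b, c)` is a morphism of `s`-triangles from `⟨x, y, δ⟩` to `⟨x', y', δ'⟩`
(both of which are understood to be `s`-triangles). -/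
def IsTriangleHom {A B Z A' B' Z' : C} (x : A ⟶ B) (y : B ⟶ Z) (δ : T.Ext Z A)
    (x' : A' ⟶ B') (y' : B' ⟶ Z') (δ' : T.Ext Z' A')
    (a : A ⟶ A') (b : B ⟶ B') (c : Z ⟶ Z') : Prop :=
  x ≫ b = a ≫ x' ∧ y ≫ c = b ≫ y' ∧ T.push Z a δ = T.pull c A' δ'

/-- Weakly extriangulated categories (on an additive category). -/
structure IsWeaklyExtriangulated [HasZeroObject C] [HasBinaryBiproducts C] : Prop where
  /-- `C(X, A) → C(X, B) → C(X, Z) → E(X, A)` is exact -/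
  c1 : ∀ {A B Z : C} (x : A ⟶ B) (y : B ⟶ Z) (δ : T.Ext Z A), T.IsTriangle x y δ → ∀ X : C,
    Function.Exact (fun f : X ⟶ A => f ≫ x) (fun g : X ⟶ B => g ≫ y) ∧
    Function.Exact (fun g : X ⟶ B => g ≫ y) (fun h : X ⟶ Z => T.pull h A δ)
  /-- `C(Z, X) → C(B, X) → C(A, X) → E(Z, X)` is exact -/
  c1' : ∀ {A B Z : C} (x : A ⟶ B) (y : B ⟶ Z) (δ : T.Ext Z A), T.IsTriangle x y δ → ∀ X : C,
    Function.Exact (fun f : Z ⟶ X => y ≫ f) (fun g : B ⟶ X => x ≫ g) ∧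
    Function.Exact (fun g : B ⟶ X => x ≫ g) (fun h : A ⟶ X => T.push Z h δ)
  c2 : ∀ A : C, T.IsTriangle (𝟙 A) (0 : A ⟶ 0) (0 : T.Ext 0 A)
  c2' : ∀ A : C, T.IsTriangle (0 : 0 ⟶ A) (𝟙 A) (0 : T.Ext A 0)
  c3 : ∀ {A B Z A' B' : C} (x : A ⟶ B) (y : B ⟶ Z) (δ : T.Ext Z A) (a : A ⟶ A')
    (x' : A' ⟶ B') (y' : B' ⟶ Z), T.IsTriangle x y δ → T.IsTriangle x' y' (T.push Z a δ) →
    ∃ b : B ⟶ B', T.IsTriangleHom x y δ x' y' (T.push Z a δ) a b (𝟙 Z) ∧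
      T.IsTriangle (biprod.lift x a) (biprod.desc b (-x')) (T.pull y' A δ)
  c3' : ∀ {A B Z Z' B' : C} (x : A ⟶ B) (y : B ⟶ Z) (δ : T.Ext Z A) (c : Z' ⟶ Z)
    (x' : A ⟶ B') (y' : B' ⟶ Z'), T.IsTriangle x y δ → T.IsTriangle x' y' (T.pull c A δ) →
    ∃ b : B' ⟶ B, T.IsTriangleHom x' y' (T.pull c A δ) x y δ (𝟙 A) b c ∧
      T.IsTriangle (biprod.lift (-y') b) (biprod.desc c y) (T.push Z x' δ)

/-- Extriangulated categories: moreover `s`-inflations and `s`-deflations are closed by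
composition. -/
structure IsExtriangulated [HasZeroObject C] [HasBinaryBiproducts C] : Prop extends T.IsWeaklyExtriangulated where
  c4 : T.inflations.IsStableUnderComposition
  c4' : T.deflations.IsStableUnderComposition

end ExtTriple

/-- An exact functor `(F, φ)`: an additive functor `F` and a natural transformation
`φ : E ⟹ E' ∘ (Fᵒᵖ × F)` of functors to abelian groups, sending `s`-triangles to `s'`-triangles. -/
structure ExtExactFunctor {C : Type u} [Category.{v} C] [Preadditive C]
    {D : Type u'} [Category.{v'} D] [Preadditive D]
    (T : ExtTriple.{w} C) (T' : ExtTriple.{w'} D) where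
  /-- the underlying functor -/
  F : C ⥤ D
  additive : F.Additive
  /-- the comparison of extensions -/
  φ : ∀ Z A : C, T.Ext Z A →+ T'.Ext (F.obj Z) (F.obj A)
  φ_push : ∀ (Z : C) {A A' : C} (a : A ⟶ A') (δ : T.Ext Z A),
    φ Z A' (T.push Z a δ) = T'.push (F.obj Z) (F.map a) (φ Z A δ)
  φ_pull : ∀ {Z' Z : C} (c : Z' ⟶ Z) (A : C) (δ : T.Ext Z A),
    φ Z' A (T.pull c A δ) = T'.pull (F.map c) (F.obj A) (φ Z A δ)
  map_triangle : ∀ {A B Z : C} (x : A ⟶ B) (y : B ⟶ Z) (δ : T.Ext Z A),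
    T.IsTriangle x y δ → T'.IsTriangle (F.map x) (F.map y) (φ Z A δ)

namespace ExtExactFunctor

variable {C : Type u} [Category.{v} C] [Preadditive C]
  {D : Type u'} [Category.{v'} D] [Preadditive D]
  {D' : Type u''} [Category.{v''} D'] [Preadditive D']
  {T : ExtTriple.{w} C} {T' : ExtTriple.{w'} D} {T'' : ExtTriple.{w''} D'}

/-- The composition `(G, ψ) ∘ (F, φ)`, in diagrammatic order. -/
def comp (P : ExtExactFunctor T T') (R : ExtExactFunctor T' T'') : ExtExactFunctor T T'' where
  F := P.F ⋙ R.F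
  additive := by
    have := P.additive
    have := R.additive
    infer_instance
  φ Z A := (R.φ (P.F.obj Z) (P.F.obj A)).comp (P.φ Z A)
  φ_push Z A A' a δ := by simp [P.φ_push, R.φ_push]
  φ_pull c A δ := by simp [P.φ_pull, R.φ_pull]
  map_triangle x y δ h := R.map_triangle _ _ _ (P.map_triangle x y δ h)

/-- Natural transformations of exact functors: natural transformations `η` of the underlying
functors such that `(η_A)_* φ(δ) = (η_Z)^* ψ(δ)`. -/
@[ext]
structure Hom (P R : ExtExactFunctor T T') where
  /-- the underlying natural transformation -/
  η : P.F ⟶ R.F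
  compat : ∀ {Z A : C} (δ : T.Ext Z A),
    T'.push (P.F.obj Z) (η.app A) (P.φ Z A δ) = T'.pull (η.app Z) (R.F.obj A) (R.φ Z A δ)

/-- The horizontal composition of a natural transformation of exact functors with an exact functor
applied first. -/
def Hom.whiskerLeft (P : ExtExactFunctor T T') {R R' : ExtExactFunctor T' T''} (α : Hom R R') :
    Hom (P.comp R) (P.comp R') where
  η := Functor.whiskerLeft P.F α.η
  compat δ := α.compat (P.φ _ _ δ)

end ExtExactFunctor

namespace CategoryTheory.MorphismProperty

variable {C : Type u} [Category.{v} C] [Preadditive C] [HasZeroObject C] [HasBinaryBiproducts C]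
  (S : MorphismProperty C)

/-- The objects `N` such that `N ⟶ 0` and `0 ⟶ N` belong to `S`. -/
def nullObjects : ObjectProperty C := fun N => S (0 : N ⟶ 0) ∧ S (0 : 0 ⟶ N)

/-- Two parallel morphisms are identified when their difference factors through an object `N`
such that `N ⟶ 0` and `0 ⟶ N` belong to `S`. -/
def nullRel : HomRel C := fun A B f g =>
  ∃ (N : C) (i : A ⟶ N) (j : N ⟶ B), S.nullObjects N ∧ f - g = i ≫ j

/-- The projection from `C` to its ideal quotient by the morphisms that factor through
`S.nullObjects`. -/
abbrev idealQuotientFunctor : C ⥤ CategoryTheory.Quotient S.nullRel :=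
  CategoryTheory.Quotient.functor S.nullRel

/-- The composites `t ∘ x ∘ s` with `s, t ∈ S` and `x ∈ P`. -/
def sandwich (P : MorphismProperty C) : MorphismProperty C := fun A B f =>
  ∃ (A' B' : C) (s : A ⟶ A') (x : A' ⟶ B') (t : B' ⟶ B), S s ∧ P x ∧ S t ∧ f = s ≫ x ≫ t

end CategoryTheory.MorphismProperty

/-!
# Localization of extriangulated categories

The extensions of the localization `Q : C ⥤ C[S⁻¹]` are the left Kan extension of `E` along
`Qᵒᵖ × Q` (`ExtTriple.locE`). As `S` admits left and right calculi of fractions, the colimits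
computing it are filtered. Hence every extension in the localization is, up to isomorphisms of its
end terms, of the form `μ(δ)` (`exists_rep_locE`), and `μ(δ)` vanishes exactly when `t_* s^* δ = 0`
for some `s, t ∈ S` (`exists_of_locMu_eq_zero`). All later arguments use only these two facts, the
calculus of fractions, and the lifting of morphisms of extensions with end terms in `S` to morphisms
of triangles with middle term in `S` (`LiftsToTriangles`).

The triangles of the localization are the sequences isomorphic to images of triangles
(`IsLocTriangle`). The image of a triangle still has long exact sequences (`isHomExact_Q`): a
lifting problem becomes, after clearing denominators, one for a triangle obtained from the given
triangle by moving an end term along a morphism of `S`, and the lifting hypothesis identifies the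
two triangles in the localization. In the same way a morphism of extensions between images of
triangles is part of a morphism of triangles (`exists_isTriangleHom_Q`). By the five lemma, two
realizations of one extension are then equivalent, so that the realization of the localization is
well defined (`isTriangle_loc_iff`), and the axioms of a weakly extriangulated category pass from
`C` to the localization.

For the universal property, a map on extensions that is compatible with a functor inverting `S`
descends along `μ` because of the two facts above (`descent`), and it preserves triangles because
triangles of a weakly extriangulated category are invariant under isomorphism
(`isTriangle_of_iso`).

Finally, a composite of two inflations of the localization is, up to isomorphism, `Q x ≫ θ ≫ Q x'`
with an isomorphism `θ`. Even if `S` is not saturated, `θ` is a fraction whose numerator is in `S`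
(`exists_leftFraction_of_iso_Q`). Pushing `x'` out along the denominator turns the composite into
the image of `x ≫ s ≫ x''` with `s ∈ S`, to which the closure of the sandwiched inflations under
composition applies. Deflations are treated dually.
-/

/-! ### Kan extensions along localizations with a calculus of fractions -/

namespace CategoryTheory

section FilteredColimits

variable {J : Type u} [Category.{v} J] [IsFiltered J] {F : J ⥤ AddCommGrpCat.{max u v w}}
  {c : Cocone F}

/-- `AsSmall` reduces to filtered categories whose objects and morphisms live in the universe of
the abelian groups, which is where preservation of filtered colimits is available. -/
lemma exists_rep_of_isColimit_addCommGrp (hc : IsColimit c) (e : c.pt) :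
    ∃ (j : J) (x : F.obj j), c.ι.app j x = e := by
  have h := hc.whiskerEquivalence (AsSmall.equiv : J ≌ AsSmall.{max u v w} J).symm
  have : IsFiltered (AsSmall.{max u v w} J) :=
    IsFiltered.of_equivalence (AsSmall.equiv : J ≌ AsSmall.{max u v w} J)
  obtain ⟨j, x, hx⟩ := Concrete.isColimit_exists_rep _ h e
  exact ⟨_, x, hx⟩

lemma exists_map_eq_zero_of_isColimit_addCommGrp (hc : IsColimit c) {j : J} (x : F.obj j)
    (hx : c.ι.app j x = 0) : ∃ (k : J) (f : j ⟶ k), F.map f x = 0 := by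
  have h := hc.whiskerEquivalence (AsSmall.equiv : J ≌ AsSmall.{max u v w} J).symm
  have : IsFiltered (AsSmall.{max u v w} J) :=
    IsFiltered.of_equivalence (AsSmall.equiv : J ≌ AsSmall.{max u v w} J)
  let j' : AsSmall.{max u v w} J := AsSmall.up.obj j
  let x' : (((AsSmall.equiv : J ≌ AsSmall.{max u v w} J).symm.functor ⋙ F).obj j') := x
  obtain ⟨k, f, g, hk⟩ := Concrete.isColimit_exists_of_rep_eq _ h (i := j') (j := j') x' 0
    (hx.trans (map_zero _).symm)
  exact ⟨_, AsSmall.down.map f, hk.trans (map_zero _)⟩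

end FilteredColimits

section Fractions

variable {C : Type u} [Category.{v} C] {D : Type u'} [Category.{v'} D] (L : C ⥤ D)
  (W : MorphismProperty C) [L.IsLocalization W] [W.HasLeftCalculusOfFractions]

include W in
/-- In other words, the objects with an invertible structure map are cofinal in
`CostructuredArrow L Y`. -/
lemma exists_fac_iso_of_hasLeftCalculusOfFractions {A : C} {Y : D} (f : L.obj A ⟶ Y) :
    ∃ (A' : C) (a : A ⟶ A') (g : L.obj A' ≅ Y), L.map a ≫ g.hom = f := by
  have := Localization.essSurj L W
  obtain ⟨φ, hφ⟩ := Localization.exists_leftFraction L W (f ≫ (L.objObjPreimageIso Y).inv)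
  refine ⟨_, φ.f, (asIso (L.map φ.s)).symm ≪≫ L.objObjPreimageIso Y, ?_⟩
  rw [← cancel_mono (L.objObjPreimageIso Y).inv, hφ]
  simp [MorphismProperty.LeftFraction.map]

include W in
lemma isFiltered_costructuredArrow_of_hasLeftCalculusOfFractions (Y : D) :
    IsFiltered (CostructuredArrow L Y) where
  nonempty := by
    have := Localization.essSurj L W
    exact ⟨CostructuredArrow.mk (L.objObjPreimageIso Y).hom⟩
  cocone_objs X₁ X₂ := by
    obtain ⟨A₁, a₁, g₁, h₁⟩ := exists_fac_iso_of_hasLeftCalculusOfFractions L W X₁.hom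
    obtain ⟨A₂, a₂, g₂, h₂⟩ := exists_fac_iso_of_hasLeftCalculusOfFractions L W X₂.hom
    obtain ⟨φ, hφ⟩ := Localization.exists_leftFraction L W (g₁.hom ≫ g₂.inv)
    refine ⟨CostructuredArrow.mk (Y := φ.Y') (inv (L.map φ.s) ≫ g₂.hom),
      CostructuredArrow.homMk (a₁ ≫ φ.f) ?_, CostructuredArrow.homMk (a₂ ≫ φ.s) ?_, trivial⟩
    · rw [← h₁]
      simp only [Functor.map_comp, CostructuredArrow.mk_hom_eq_self, Category.assoc]
      congr 1
      rw [← cancel_mono g₂.inv, hφ]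
      simp [MorphismProperty.LeftFraction.map]
    · rw [← h₂]
      simp
  cocone_maps X₁ X₂ p q := by
    obtain ⟨A, a, g, h⟩ := exists_fac_iso_of_hasLeftCalculusOfFractions L W X₂.hom
    have hpq : L.map (p.left ≫ a) = L.map (q.left ≫ a) := by
      rw [← cancel_mono g.hom, L.map_comp, L.map_comp, Category.assoc, Category.assoc, h]
      exact (CostructuredArrow.w p).trans (CostructuredArrow.w q).symm
    obtain ⟨Z, t, ht, fac⟩ := (MorphismProperty.map_eq_iff_postcomp L W _ _).1 hpq
    have := Localization.inverts L W _ ht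
    refine ⟨CostructuredArrow.mk (Y := Z) (inv (L.map t) ≫ g.hom),
      CostructuredArrow.homMk (a ≫ t) ?_, ?_⟩
    · rw [← h]
      simp
    · ext
      simpa using fac

end Fractions

section KanExtension

variable {C : Type u} [Category.{v} C] {D : Type u'} [Category.{v'} D] (L : C ⥤ D)
  (W : MorphismProperty C) [L.IsLocalization W] [W.HasLeftCalculusOfFractions]
  (H : C ⥤ AddCommGrpCat.{max u v v' w})

include W in
/-- Along a localization functor with a left calculus of fractions, every element of the left Kan
extension is represented by one element of the original functor: the colimits defining the Kan
extension are filtered. -/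
lemma exists_rep_pointwiseLeftKanExtension {Y : D} (e : (L.pointwiseLeftKanExtension H).obj Y) :
    ∃ (A : C) (g : L.obj A ≅ Y) (h : H.obj A), (L.pointwiseLeftKanExtension H).map g.hom
      ((L.pointwiseLeftKanExtensionUnit H).app A h) = e := by
  have := isFiltered_costructuredArrow_of_hasLeftCalculusOfFractions L W Y
  obtain ⟨j, x, hx⟩ := exists_rep_of_isColimit_addCommGrp.{max u v v' w}
    (L.pointwiseLeftKanExtensionIsPointwiseLeftKanExtension H Y) e
  obtain ⟨A', a, g, hg⟩ := exists_fac_iso_of_hasLeftCalculusOfFractions L W j.hom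
  refine ⟨A', g, H.map a x, hx ▸ ?_⟩
  have h := ConcreteCategory.congr_hom ((L.pointwiseLeftKanExtensionUnit H).naturality a) x
  have h' := ConcreteCategory.congr_hom ((L.pointwiseLeftKanExtension H).map_comp (L.map a) g.hom)
    ((L.pointwiseLeftKanExtensionUnit H).app _ x)
  rw [hg] at h'
  exact (congrArg ((L.pointwiseLeftKanExtension H).map g.hom) h).trans h'.symm

include W in
/-- The kernel of the unit of the Kan extension consists of the elements killed by a morphism that
is inverted. -/
lemma exists_map_eq_zero_pointwiseLeftKanExtension {A : C} (h : H.obj A)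
    (hh : (L.pointwiseLeftKanExtensionUnit H).app A h = 0) :
    ∃ (A' : C) (t : A ⟶ A'), W t ∧ H.map t h = 0 := by
  have := isFiltered_costructuredArrow_of_hasLeftCalculusOfFractions L W (L.obj A)
  obtain ⟨k, f, hf⟩ := exists_map_eq_zero_of_isColimit_addCommGrp.{max u v v' w}
    (L.pointwiseLeftKanExtensionIsPointwiseLeftKanExtension H (L.obj A))
    (j := CostructuredArrow.mk (𝟙 (L.obj A))) h
    ((congrArg ((L.pointwiseLeftKanExtension H).map (𝟙 _)) hh).trans (map_zero _))
  replace hf : H.map f.left h = 0 := hf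
  have hk : L.map f.left ≫ k.hom = 𝟙 _ := CostructuredArrow.w f
  obtain ⟨φ, hφ⟩ := Localization.exists_leftFraction L W k.hom
  obtain ⟨Z, t, ht, fac⟩ := (MorphismProperty.map_eq_iff_postcomp L W (f.left ≫ φ.f) φ.s).1 (by
    rw [L.map_comp, ← φ.map_comp_map_s L (Localization.inverts L W), ← hφ, reassoc_of% hk])
  refine ⟨Z, φ.s ≫ t, W.comp_mem _ _ φ.hs ht, ?_⟩
  rw [← fac, Category.assoc, H.map_comp]
  exact (congrArg (H.map (φ.f ≫ t)) hf).trans (map_zero _)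

end KanExtension

instance MorphismProperty.prod_hasLeftCalculusOfFractions {C₁ : Type u} [Category.{v} C₁]
    {C₂ : Type u'} [Category.{v'} C₂] (W₁ : MorphismProperty C₁) (W₂ : MorphismProperty C₂)
    [W₁.HasLeftCalculusOfFractions] [W₂.HasLeftCalculusOfFractions] :
    (W₁.prod W₂).HasLeftCalculusOfFractions where
  id_mem X := ⟨W₁.id_mem _, W₂.id_mem _⟩
  comp_mem _ _ hf hg := ⟨W₁.comp_mem _ _ hf.1 hg.1, W₂.comp_mem _ _ hf.2 hg.2⟩
  exists_leftFraction _ _ φ := by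
    obtain ⟨ψ₁, h₁⟩ := (RightFraction.mk φ.s.1 φ.hs.1 φ.f.1).exists_leftFraction
    obtain ⟨ψ₂, h₂⟩ := (RightFraction.mk φ.s.2 φ.hs.2 φ.f.2).exists_leftFraction
    exact ⟨LeftFraction.mk (Y' := (_, _)) (ψ₁.f, ψ₂.f) (ψ₁.s, ψ₂.s) ⟨ψ₁.hs, ψ₂.hs⟩,
      Prod.ext h₁ h₂⟩
  ext _ _ _ f₁ f₂ s hs h := by
    obtain ⟨Z₁, t₁, ht₁, h₁⟩ := HasLeftCalculusOfFractions.ext f₁.1 f₂.1 s.1 hs.1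
      (congrArg _root_.Prod.fst h)
    obtain ⟨Z₂, t₂, ht₂, h₂⟩ := HasLeftCalculusOfFractions.ext f₁.2 f₂.2 s.2 hs.2
      (congrArg _root_.Prod.snd h)
    exact ⟨(Z₁, Z₂), (t₁, t₂), ⟨ht₁, ht₂⟩, Prod.ext h₁ h₂⟩

end CategoryTheory

/-! ### Extensions in the localization -/

namespace ExtTriple

section Bifunctor

variable {C : Type u} [Category.{v} C] (E : Cᵒᵖ ⥤ C ⥤ AddCommGrpCat.{w})

/-- The covariant action of a bifunctor to abelian groups; for `T : ExtTriple C`,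
`T.push` is `biPush T.E` by definition. -/
def biPush (Z : C) {A A' : C} (a : A ⟶ A') : (E.obj (op Z)).obj A →+ (E.obj (op Z)).obj A' :=
  ((E.obj (op Z)).map a).hom

/-- The contravariant action of a bifunctor to abelian groups; for `T : ExtTriple C`,
`T.pull` is `biPull T.E` by definition. -/
def biPull {Z' Z : C} (c : Z' ⟶ Z) (A : C) : (E.obj (op Z)).obj A →+ (E.obj (op Z')).obj A :=
  ((E.map c.op).app A).hom

lemma biPush_id (Z A : C) (x : (E.obj (op Z)).obj A) : biPush E Z (𝟙 A) x = x := by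
  simp [biPush]

lemma biPull_id (Z A : C) (x : (E.obj (op Z)).obj A) : biPull E (𝟙 Z) A x = x := by
  simp [biPull]

lemma biPush_comp (Z : C) {A A' A'' : C} (a : A ⟶ A') (b : A' ⟶ A'') (x : (E.obj (op Z)).obj A) :
    biPush E Z (a ≫ b) x = biPush E Z b (biPush E Z a x) := by
  simp [biPush]

lemma biPull_comp {Z'' Z' Z : C} (c : Z'' ⟶ Z') (d : Z' ⟶ Z) (A : C)
    (x : (E.obj (op Z)).obj A) :
    biPull E (c ≫ d) A x = biPull E c A (biPull E d A x) := by
  simp [biPull]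

lemma biPush_biPull {Z' Z A A' : C} (c : Z' ⟶ Z) (a : A ⟶ A') (x : (E.obj (op Z)).obj A) :
    biPush E Z' a (biPull E c A x) = biPull E c A' (biPush E Z a x) :=
  (ConcreteCategory.congr_hom ((E.map c.op).naturality a) x).symm

end Bifunctor

section Actions

variable {C : Type u} [Category.{v} C] [Preadditive C] (T : ExtTriple.{w} C)

lemma push_id (Z A : C) (x : T.Ext Z A) : T.push Z (𝟙 A) x = x := biPush_id T.E Z A x

lemma pull_id (Z A : C) (x : T.Ext Z A) : T.pull (𝟙 Z) A x = x := biPull_id T.E Z A x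

lemma push_comp (Z : C) {A A' A'' : C} (a : A ⟶ A') (b : A' ⟶ A'') (x : T.Ext Z A) :
    T.push Z (a ≫ b) x = T.push Z b (T.push Z a x) := biPush_comp T.E Z a b x

lemma pull_comp {Z'' Z' Z : C} (c : Z'' ⟶ Z') (d : Z' ⟶ Z) (A : C) (x : T.Ext Z A) :
    T.pull (c ≫ d) A x = T.pull c A (T.pull d A x) := biPull_comp T.E c d A x

lemma push_pull {Z' Z A A' : C} (c : Z' ⟶ Z) (a : A ⟶ A') (x : T.Ext Z A) :
    T.push Z' a (T.pull c A x) = T.pull c A' (T.push Z a x) := biPush_biPull T.E c a x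

lemma push_add (Z : C) {A A' : C} (a b : A ⟶ A') (x : T.Ext Z A) :
    T.push Z (a + b) x = T.push Z a x + T.push Z b x := by
  have := T.additive_right Z
  simp [push, Functor.map_add]

lemma pull_add {Z' Z : C} (c d : Z' ⟶ Z) (A : C) (x : T.Ext Z A) :
    T.pull (c + d) A x = T.pull c A x + T.pull d A x := by
  have := T.additive_left
  simp [pull, Functor.map_add]

lemma push_hom_inv {Z A A' : C} (a : A ≅ A') (x : T.Ext Z A) :
    T.push Z a.inv (T.push Z a.hom x) = x := by
  rw [← push_comp, a.hom_inv_id, push_id]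

lemma pull_inv_hom {Z' Z A : C} (c : Z' ≅ Z) (x : T.Ext Z A) :
    T.pull c.inv A (T.pull c.hom A x) = x := by
  rw [← pull_comp, c.inv_hom_id, pull_id]

lemma push_injective {Z A A' : C} (a : A ⟶ A') [IsIso a] : Function.Injective (T.push Z a) :=
  Function.LeftInverse.injective (g := T.push Z (inv a))
    (fun x => by rw [← push_comp, IsIso.hom_inv_id, push_id])

lemma pull_injective {Z' Z A : C} (c : Z' ⟶ Z) [IsIso c] : Function.Injective (T.pull c A) :=
  Function.LeftInverse.injective (g := T.pull (inv c) A)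
    (fun x => by rw [← pull_comp, IsIso.inv_hom_id, pull_id])

end Actions

end ExtTriple

namespace CategoryTheory.MorphismProperty

variable {C : Type u} [Category.{v} C] (S : MorphismProperty C)

lemma Q_obj_surjective : Function.Surjective S.Q.obj :=
  (Localization.Construction.objEquiv S).surjective

lemma exists_leftFraction_Q [S.HasLeftCalculusOfFractions] {X Y : C}
    (f : S.Q.obj X ⟶ S.Q.obj Y) :
    ∃ (M : C) (f' : X ⟶ M) (t : Y ⟶ M), S t ∧ f ≫ S.Q.map t = S.Q.map f' := by
  obtain ⟨φ, rfl⟩ := Localization.exists_leftFraction S.Q S f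
  exact ⟨_, φ.f, φ.s, φ.hs, by simp⟩

lemma exists_rightFraction_Q [S.HasRightCalculusOfFractions] {X Y : C}
    (f : S.Q.obj X ⟶ S.Q.obj Y) :
    ∃ (M : C) (s : M ⟶ X) (f' : M ⟶ Y), S s ∧ S.Q.map s ≫ f = S.Q.map f' := by
  obtain ⟨φ, rfl⟩ := Localization.exists_rightFraction S.Q S f
  exact ⟨_, φ.s, φ.f, φ.hs, by simp⟩

lemma exists_leftFraction_Q₂ [S.HasLeftCalculusOfFractions] {X X' Y : C}
    (f : S.Q.obj X ⟶ S.Q.obj Y) (g : S.Q.obj X' ⟶ S.Q.obj Y) :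
    ∃ (M : C) (f' : X ⟶ M) (g' : X' ⟶ M) (t : Y ⟶ M), S t ∧ f ≫ S.Q.map t = S.Q.map f' ∧
      g ≫ S.Q.map t = S.Q.map g' := by
  obtain ⟨M, f', t, ht, hf⟩ := S.exists_leftFraction_Q f
  obtain ⟨N, g', r, hr, hg⟩ := S.exists_leftFraction_Q g
  obtain ⟨ψ, hψ⟩ := (RightFraction.mk t ht r).exists_leftFraction
  refine ⟨_, f' ≫ ψ.f, g' ≫ ψ.s, r ≫ ψ.s, S.comp_mem _ _ hr ψ.hs, ?_, ?_⟩
  · rw [show r ≫ ψ.s = t ≫ ψ.f from hψ, Functor.map_comp, reassoc_of% hf, Functor.map_comp]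
  · rw [Functor.map_comp, reassoc_of% hg, Functor.map_comp]

lemma exists_rightFraction_Q₂ [S.HasRightCalculusOfFractions] {X Y Y' : C}
    (f : S.Q.obj X ⟶ S.Q.obj Y) (g : S.Q.obj X ⟶ S.Q.obj Y') :
    ∃ (M : C) (s : M ⟶ X) (f' : M ⟶ Y) (g' : M ⟶ Y'), S s ∧ S.Q.map s ≫ f = S.Q.map f' ∧
      S.Q.map s ≫ g = S.Q.map g' := by
  obtain ⟨M, s, f', hs, hf⟩ := S.exists_rightFraction_Q f
  obtain ⟨N, r, g', hr, hg⟩ := S.exists_rightFraction_Q g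
  obtain ⟨ψ, hψ⟩ := (LeftFraction.mk s r hr).exists_rightFraction
  refine ⟨_, ψ.s ≫ s, ψ.s ≫ f', ψ.f ≫ g', S.comp_mem _ _ ψ.hs hs, ?_, ?_⟩
  · rw [Functor.map_comp, Category.assoc, hf, Functor.map_comp]
  · rw [show ψ.s ≫ s = ψ.f ≫ r from hψ, Functor.map_comp, Category.assoc, hg, Functor.map_comp]

end CategoryTheory.MorphismProperty

namespace ExtTriple

variable {C : Type u} [Category.{v} C] [Preadditive C] (T : ExtTriple.{w} C)
  (S : MorphismProperty C)

/-- The left Kan extension of the bifunctor `T.E` along `Qᵒᵖ × Q`; the values are lifted to a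
universe that has the colimits in question. -/
noncomputable def locE : S.Localizationᵒᵖ ⥤ S.Localization ⥤ AddCommGrpCat.{max u v w} :=
  Functor.curry.obj ((S.Q.op.prod S.Q).pointwiseLeftKanExtension
    (Functor.uncurry.obj T.E ⋙ AddCommGrpCat.uliftFunctor.{max u v, w}))

/-- The unit of the Kan extension. -/
noncomputable def locMu (Z A : C) :
    T.Ext Z A →+ ((T.locE S).obj (op (S.Q.obj Z))).obj (S.Q.obj A) :=
  (((S.Q.op.prod S.Q).pointwiseLeftKanExtensionUnit
    (Functor.uncurry.obj T.E ⋙ AddCommGrpCat.uliftFunctor.{max u v, w})).app (op Z, A)).hom.comp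
    AddEquiv.ulift.symm.toAddMonoidHom

lemma locMu_push (Z : C) {A A' : C} (a : A ⟶ A') (δ : T.Ext Z A) :
    T.locMu S Z A' (T.push Z a δ) = biPush (T.locE S) _ (S.Q.map a) (T.locMu S Z A δ) := by
  have h := ConcreteCategory.congr_hom (((S.Q.op.prod S.Q).pointwiseLeftKanExtensionUnit
    (Functor.uncurry.obj T.E ⋙ AddCommGrpCat.uliftFunctor.{max u v, w})).naturality
      (X := (op Z, A)) (Y := (op Z, A')) (𝟙 _, a)) (ULift.up δ)
  have h₁ : (Functor.uncurry.obj T.E ⋙ AddCommGrpCat.uliftFunctor.{max u v, w}).map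
      (X := (op Z, A)) (Y := (op Z, A')) (𝟙 _, a) (ULift.up δ) = ULift.up (T.push Z a δ) :=
    congrArg ULift.up (by simp [push]; rfl)
  have h₂ : (S.Q.op.prod S.Q).map (X := (op Z, A)) (Y := (op Z, A')) (𝟙 _, a) =
      (𝟙 _, S.Q.map a) := Prod.ext (S.Q.op.map_id _) rfl
  refine (congrArg _ h₁.symm).trans (h.trans ?_)
  exact ConcreteCategory.congr_hom (congrArg ((S.Q.op.prod S.Q).pointwiseLeftKanExtension
    (Functor.uncurry.obj T.E ⋙ AddCommGrpCat.uliftFunctor.{max u v, w})).map h₂) _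

lemma locMu_pull {Z' Z : C} (c : Z' ⟶ Z) (A : C) (δ : T.Ext Z A) :
    T.locMu S Z' A (T.pull c A δ) = biPull (T.locE S) (S.Q.map c) _ (T.locMu S Z A δ) := by
  have h := ConcreteCategory.congr_hom (((S.Q.op.prod S.Q).pointwiseLeftKanExtensionUnit
    (Functor.uncurry.obj T.E ⋙ AddCommGrpCat.uliftFunctor.{max u v, w})).naturality
      (X := (op Z, A)) (Y := (op Z', A)) (c.op, 𝟙 _)) (ULift.up δ)
  have h₁ : (Functor.uncurry.obj T.E ⋙ AddCommGrpCat.uliftFunctor.{max u v, w}).map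
      (X := (op Z, A)) (Y := (op Z', A)) (c.op, 𝟙 _) (ULift.up δ) = ULift.up (T.pull c A δ) :=
    congrArg ULift.up (by simp [pull]; rfl)
  have h₂ : (S.Q.op.prod S.Q).map (X := (op Z, A)) (Y := (op Z', A)) (c.op, 𝟙 _) =
      ((S.Q.map c).op, 𝟙 _) := Prod.ext rfl (S.Q.map_id _)
  refine (congrArg _ h₁.symm).trans (h.trans ?_)
  exact ConcreteCategory.congr_hom (congrArg ((S.Q.op.prod S.Q).pointwiseLeftKanExtension
    (Functor.uncurry.obj T.E ⋙ AddCommGrpCat.uliftFunctor.{max u v, w})).map h₂) _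

variable [S.HasLeftCalculusOfFractions] [S.HasRightCalculusOfFractions]

/-- Every extension in the localization is, up to isomorphisms of its end terms, in the image
of `locMu`. -/
lemma exists_rep_locE {X Y : S.Localization} (e : ((T.locE S).obj (op X)).obj Y) :
    ∃ (Z A : C) (c : S.Q.obj Z ≅ X) (a : S.Q.obj A ≅ Y) (δ : T.Ext Z A),
      biPush (T.locE S) _ a.hom (T.locMu S Z A δ) = biPull (T.locE S) c.hom _ e := by
  obtain ⟨⟨Z, A⟩, g, δ, h⟩ := exists_rep_pointwiseLeftKanExtension (S.Q.op.prod S.Q) (S.op.prod S)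
    (Functor.uncurry.obj T.E ⋙ AddCommGrpCat.uliftFunctor.{max u v, w}) (Y := (op X, Y)) e
  have h₁ : g.hom.1 ≫ g.inv.1 = 𝟙 _ := congrArg _root_.Prod.fst g.hom_inv_id
  have h₂ : g.inv.1 ≫ g.hom.1 = 𝟙 _ := congrArg _root_.Prod.fst g.inv_hom_id
  have h₃ : g.hom.2 ≫ g.inv.2 = 𝟙 _ := congrArg _root_.Prod.snd g.hom_inv_id
  have h₄ : g.inv.2 ≫ g.hom.2 = 𝟙 _ := congrArg _root_.Prod.snd g.inv_hom_id
  refine ⟨Z.unop, A, ⟨g.inv.1.unop, g.hom.1.unop, Quiver.Hom.op_inj h₁, Quiver.Hom.op_inj h₂⟩,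
    ⟨g.hom.2, g.inv.2, h₃, h₄⟩, δ.down, ?_⟩
  rw [← h]
  have h₅ : g.hom ≫ ((g.inv.1, 𝟙 _) : (op X, Y) ⟶ (op (S.Q.obj Z.unop), Y)) =
      (𝟙 _, g.hom.2) := Prod.ext h₁ (Category.comp_id _)
  have h₆ := ((S.Q.op.prod S.Q).pointwiseLeftKanExtension
    (Functor.uncurry.obj T.E ⋙ AddCommGrpCat.uliftFunctor.{max u v, w})).map_comp g.hom
      ((g.inv.1, 𝟙 _) : (op X, Y) ⟶ (op (S.Q.obj Z.unop), Y))
  rw [h₅] at h₆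
  exact ConcreteCategory.congr_hom h₆ _

/-- The kernel of `locMu` consists of the extensions killed by morphisms of `S`. -/
lemma exists_of_locMu_eq_zero {Z A : C} (δ : T.Ext Z A) (h : T.locMu S Z A δ = 0) :
    ∃ (Z' A' : C) (s : Z' ⟶ Z) (t : A ⟶ A'), S s ∧ S t ∧ T.push _ t (T.pull s A δ) = 0 := by
  obtain ⟨⟨Z', A'⟩, ⟨s, t⟩, ⟨hs, ht⟩, h⟩ := exists_map_eq_zero_pointwiseLeftKanExtension
    (S.Q.op.prod S.Q) (S.op.prod S)
    (Functor.uncurry.obj T.E ⋙ AddCommGrpCat.uliftFunctor.{max u v, w}) (A := (op Z, A))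
      (ULift.up δ) h
  refine ⟨Z'.unop, A', s.unop, t, hs, ht, ?_⟩
  exact congrArg ULift.down h

lemma biPush_locE_add {X Y Y' : S.Localization} (f g : Y ⟶ Y')
    (e : ((T.locE S).obj (op X)).obj Y) :
    biPush (T.locE S) X (f + g) e = biPush (T.locE S) X f e + biPush (T.locE S) X g e := by
  -- it suffices to treat the extensions in the image of `locMu`
  suffices h : ∀ (Z A : C) (δ : T.Ext Z A) (f g : S.Q.obj A ⟶ Y'),
      biPush (T.locE S) _ (f + g) (T.locMu S Z A δ) =
        biPush (T.locE S) _ f (T.locMu S Z A δ) + biPush (T.locE S) _ g (T.locMu S Z A δ) by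
    obtain ⟨Z, A, c, a, δ, hδ⟩ := T.exists_rep_locE S e
    have he : e = biPull (T.locE S) c.inv _ (biPush (T.locE S) _ a.hom (T.locMu S Z A δ)) := by
      rw [hδ, ← biPull_comp, c.inv_hom_id, biPull_id]
    rw [he]
    simp only [biPush_biPull, ← biPush_comp, Preadditive.comp_add, h, map_add]
  intro Z A δ f g
  obtain ⟨B, rfl⟩ := S.Q_obj_surjective Y'
  obtain ⟨M, f', g', t, ht, hf, hg⟩ := S.exists_leftFraction_Q₂ f g
  have := Localization.inverts S.Q S t ht
  rw [← IsIso.eq_comp_inv] at hf hg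
  rw [hf, hg, ← Preadditive.add_comp, ← S.Q.map_add]
  simp only [biPush_comp, ← locMu_push, ← map_add, push_add]

lemma biPull_locE_add {X X' Y : S.Localization} (f g : X' ⟶ X)
    (e : ((T.locE S).obj (op X)).obj Y) :
    biPull (T.locE S) (f + g) Y e = biPull (T.locE S) f Y e + biPull (T.locE S) g Y e := by
  -- it suffices to treat the extensions in the image of `locMu`
  suffices h : ∀ (Z A : C) (δ : T.Ext Z A) (f g : X' ⟶ S.Q.obj Z),
      biPull (T.locE S) (f + g) _ (T.locMu S Z A δ) =
        biPull (T.locE S) f _ (T.locMu S Z A δ) + biPull (T.locE S) g _ (T.locMu S Z A δ) by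
    obtain ⟨Z, A, c, a, δ, hδ⟩ := T.exists_rep_locE S e
    have he : e = biPull (T.locE S) c.inv _ (biPush (T.locE S) _ a.hom (T.locMu S Z A δ)) := by
      rw [hδ, ← biPull_comp, c.inv_hom_id, biPull_id]
    rw [he]
    simp only [← biPull_comp, ← biPush_biPull, Preadditive.add_comp, h, map_add]
  intro Z A δ f g
  obtain ⟨B, rfl⟩ := S.Q_obj_surjective X'
  obtain ⟨M, s, f', g', hs, hf, hg⟩ := S.exists_rightFraction_Q₂ f g
  have := Localization.inverts S.Q S s hs
  rw [← IsIso.eq_inv_comp] at hf hg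
  rw [hf, hg, ← Preadditive.comp_add, ← S.Q.map_add]
  simp only [biPull_comp, ← locMu_pull, ← map_add, pull_add]

end ExtTriple

/-! ### Long exact sequences and the realization of the localization -/

namespace ExtTriple

section ExactTriangles

variable {C : Type u} [Category.{v} C] [Preadditive C] (T : ExtTriple.{w} C)

/-- The long exact sequences attached to `A ⟶ B ⟶ Z` and `δ ∈ E(Z, A)`, spelled out in terms of
elements. The realization of `δ` plays no role. -/
structure IsHomExact {A B Z : C} (x : A ⟶ B) (y : B ⟶ Z) (δ : T.Ext Z A) : Prop where
  comp_eq_zero : x ≫ y = 0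
  pull_proj : T.pull y A δ = 0
  push_inc : T.push Z x δ = 0
  lift_inc : ∀ {X : C} (g : X ⟶ B), g ≫ y = 0 → ∃ f : X ⟶ A, f ≫ x = g
  lift_proj : ∀ {X : C} (h : X ⟶ Z), T.pull h A δ = 0 → ∃ g : X ⟶ B, g ≫ y = h
  desc_proj : ∀ {X : C} (g : B ⟶ X), x ≫ g = 0 → ∃ f : Z ⟶ X, y ≫ f = g
  desc_inc : ∀ {X : C} (h : A ⟶ X), T.push Z h δ = 0 → ∃ g : B ⟶ X, x ≫ g = h

variable {T}

lemma exists_isTriangle {Z A : C} (δ : T.Ext Z A) :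
    ∃ (B : C) (x : A ⟶ B) (y : B ⟶ Z), T.IsTriangle x y δ := by
  obtain ⟨⟨B, x, y⟩, h⟩ := Quotient.exists_rep (T.s δ)
  exact ⟨B, x, y, h.symm⟩

lemma IsTriangle.of_iso_mid {A B B' Z : C} {x : A ⟶ B} {y : B ⟶ Z} {x' : A ⟶ B'} {y' : B' ⟶ Z}
    {δ : T.Ext Z A} (h : T.IsTriangle x y δ) (b : B ≅ B') (hx : x ≫ b.hom = x')
    (hy : b.hom ≫ y' = y) : T.IsTriangle x' y' δ :=
  h.trans (Quotient.sound (s := ShortSeq.setoid A Z) ⟨b, hx, hy⟩)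

lemma IsTriangle.exists_iso_mid {A B B' Z : C} {x : A ⟶ B} {y : B ⟶ Z} {x' : A ⟶ B'}
    {y' : B' ⟶ Z} {δ : T.Ext Z A} (h : T.IsTriangle x y δ) (h' : T.IsTriangle x' y' δ) :
    ∃ b : B ≅ B', x ≫ b.hom = x' ∧ b.hom ≫ y' = y :=
  Quotient.exact (s := ShortSeq.setoid A Z) (h.symm.trans h')

lemma IsHomExact.exact {A B Z : C} {x : A ⟶ B} {y : B ⟶ Z} {δ : T.Ext Z A}
    (h : T.IsHomExact x y δ) (X : C) :
    Function.Exact (fun f : X ⟶ A => f ≫ x) (fun g : X ⟶ B => g ≫ y) ∧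
    Function.Exact (fun g : X ⟶ B => g ≫ y) (fun h : X ⟶ Z => T.pull h A δ) := by
  refine ⟨fun g => ⟨fun hg => h.lift_inc g hg, ?_⟩, fun g => ⟨fun hg => h.lift_proj g hg, ?_⟩⟩
  · rintro ⟨f, rfl⟩
    simp [h.comp_eq_zero]
  · rintro ⟨f, rfl⟩
    simp [pull_comp, h.pull_proj]

lemma IsHomExact.exact' {A B Z : C} {x : A ⟶ B} {y : B ⟶ Z} {δ : T.Ext Z A}
    (h : T.IsHomExact x y δ) (X : C) :
    Function.Exact (fun f : Z ⟶ X => y ≫ f) (fun g : B ⟶ X => x ≫ g) ∧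
    Function.Exact (fun g : B ⟶ X => x ≫ g) (fun h : A ⟶ X => T.push Z h δ) := by
  refine ⟨fun g => ⟨fun hg => h.desc_proj g hg, ?_⟩, fun g => ⟨fun hg => h.desc_inc g hg, ?_⟩⟩
  · rintro ⟨f, rfl⟩
    simp [reassoc_of% h.comp_eq_zero]
  · rintro ⟨f, rfl⟩
    simp [push_comp, h.push_inc]

lemma IsHomExact.of_iso {A B Z A' B' Z' : C} {x : A ⟶ B} {y : B ⟶ Z} {δ : T.Ext Z A}
    {x' : A' ⟶ B'} {y' : B' ⟶ Z'} {δ' : T.Ext Z' A'} (h : T.IsHomExact x y δ)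
    (a : A ≅ A') (b : B ≅ B') (c : Z ≅ Z')
    (H : T.IsTriangleHom x y δ x' y' δ' a.hom b.hom c.hom) : T.IsHomExact x' y' δ' := by
  obtain ⟨hx, hy, hδ⟩ := H
  have hx' : x' = a.inv ≫ x ≫ b.hom := by rw [hx, a.inv_hom_id_assoc]
  have hy' : y' = b.inv ≫ y ≫ c.hom := by rw [hy, b.inv_hom_id_assoc]
  have hδ' : δ' = T.pull c.inv _ (T.push _ a.hom δ) := by rw [hδ, pull_inv_hom]
  subst hx' hy' hδ'
  refine ⟨?_, ?_, ?_, fun {X} g hg => ?_, fun {X} g hg => ?_, fun {X} g hg => ?_,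
    fun {X} g hg => ?_⟩
  · simp [reassoc_of% h.comp_eq_zero]
  · rw [← pull_comp]
    simp [pull_comp, ← push_pull, h.pull_proj]
  · rw [push_pull, ← push_comp]
    simp [push_comp, h.push_inc]
  · obtain ⟨f, hf⟩ := h.lift_inc (g ≫ b.inv) (by
      rw [← cancel_mono c.hom]
      simpa using hg)
    exact ⟨f ≫ a.hom, by simp [reassoc_of% hf]⟩
  · obtain ⟨f, hf⟩ := h.lift_proj (g ≫ c.inv) (by
      apply T.push_injective a.hom
      rw [← pull_comp] at hg
      rw [push_pull, hg, map_zero])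
    exact ⟨f ≫ b.hom, by simp [reassoc_of% hf]⟩
  · obtain ⟨f, hf⟩ := h.desc_proj (b.hom ≫ g) (by
      rw [← cancel_epi a.inv]
      simpa using hg)
    exact ⟨c.inv ≫ f, by simp [hf]⟩
  · obtain ⟨f, hf⟩ := h.desc_inc (a.hom ≫ g) (by
      apply T.pull_injective c.inv
      rw [push_pull, ← push_comp] at hg
      rw [hg, map_zero])
    exact ⟨b.inv ≫ f, by simp [hf]⟩

/-- The five lemma for the long exact sequences. As these do not continue to the left of `A` or to
the right of `Z`, they only provide a section and a retraction of `b`. -/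
lemma IsHomExact.isIso_mid {A B Z A' B' Z' : C} {x : A ⟶ B} {y : B ⟶ Z} {δ : T.Ext Z A}
    {x' : A' ⟶ B'} {y' : B' ⟶ Z'} {δ' : T.Ext Z' A'} (h : T.IsHomExact x y δ)
    (h' : T.IsHomExact x' y' δ') {a : A ⟶ A'} {b : B ⟶ B'} {c : Z ⟶ Z'}
    (H : T.IsTriangleHom x y δ x' y' δ' a b c) [IsIso a] [IsIso c] : IsIso b := by
  obtain ⟨hx, hy, hδ⟩ := H
  obtain ⟨r, hr⟩ : ∃ r : B' ⟶ B, r ≫ b = 𝟙 _ := by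
    obtain ⟨g, hg⟩ := h.lift_proj (y' ≫ inv c) (by
      apply T.push_injective a
      rw [push_pull, hδ, ← pull_comp, Category.assoc, IsIso.inv_hom_id, Category.comp_id,
        h'.pull_proj, map_zero])
    obtain ⟨f, hf⟩ := h'.lift_inc (𝟙 _ - g ≫ b) (by
      rw [Preadditive.sub_comp, Category.assoc, ← hy, reassoc_of% hg]
      simp)
    exact ⟨g + f ≫ inv a ≫ x, by simp [hx, hf]⟩
  obtain ⟨l, hl⟩ : ∃ l : B' ⟶ B, b ≫ l = 𝟙 _ := by
    obtain ⟨g, hg⟩ := h'.desc_inc (inv a ≫ x) (by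
      apply T.pull_injective c
      rw [← push_pull, ← hδ, ← push_comp, IsIso.hom_inv_id_assoc, h.push_inc, map_zero])
    obtain ⟨f, hf⟩ := h.desc_proj (𝟙 _ - b ≫ g) (by
      rw [Preadditive.comp_sub, reassoc_of% hx, hg]
      simp)
    exact ⟨g + y' ≫ inv c ≫ f, by simp [← reassoc_of% hy, hf]⟩
  have hlr : l = r := by rw [← Category.id_comp l, ← hr, Category.assoc, hl, Category.comp_id]
  exact ⟨l, hl, hlr ▸ hr⟩

variable [HasZeroObject C] [HasBinaryBiproducts C]

lemma IsWeaklyExtriangulated.isHomExact (hT : T.IsWeaklyExtriangulated) {A B Z : C} {x : A ⟶ B}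
    {y : B ⟶ Z} {δ : T.Ext Z A} (h : T.IsTriangle x y δ) : T.IsHomExact x y δ where
  comp_eq_zero := by simpa using ((hT.c1 x y δ h A).1 x).2 ⟨𝟙 A, by simp⟩
  pull_proj := ((hT.c1 x y δ h B).2 y).2 ⟨𝟙 B, by simp⟩
  push_inc := ((hT.c1' x y δ h B).2 x).2 ⟨𝟙 B, by simp⟩
  lift_inc g hg := ((hT.c1 x y δ h _).1 g).1 hg
  lift_proj g hg := ((hT.c1 x y δ h _).2 g).1 hg
  desc_proj g hg := ((hT.c1' x y δ h _).1 g).1 hg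
  desc_inc g hg := ((hT.c1' x y δ h _).2 g).1 hg

lemma IsWeaklyExtriangulated.exists_isTriangleHom (hT : T.IsWeaklyExtriangulated)
    {A B Z A' B' Z' : C} {x : A ⟶ B} {y : B ⟶ Z} {δ : T.Ext Z A} {x' : A' ⟶ B'} {y' : B' ⟶ Z'}
    {δ' : T.Ext Z' A'} (h : T.IsTriangle x y δ) (h' : T.IsTriangle x' y' δ') (a : A ⟶ A')
    (c : Z ⟶ Z') (hδ : T.push Z a δ = T.pull c A' δ') :
    ∃ b : B ⟶ B', T.IsTriangleHom x y δ x' y' δ' a b c := by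
  -- the morphism factors through a realization of `a_* δ = c^* δ'`
  obtain ⟨B₁, x₁, y₁, h₁⟩ := exists_isTriangle (T.push Z a δ)
  obtain ⟨b, ⟨hbx, hby, -⟩, -⟩ := hT.c3 x y δ a x₁ y₁ h h₁
  obtain ⟨b', ⟨hbx', hby', -⟩, -⟩ := hT.c3' x' y' δ' c x₁ y₁ h' (hδ ▸ h₁)
  refine ⟨b ≫ b', ?_, ?_, hδ⟩
  · rw [reassoc_of% hbx, hbx', Category.id_comp]
  · rw [Category.assoc, ← hby', ← reassoc_of% hby]

lemma IsWeaklyExtriangulated.isTriangle_of_iso (hT : T.IsWeaklyExtriangulated)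
    {A B Z A' B' Z' : C} {x : A ⟶ B} {y : B ⟶ Z} {δ : T.Ext Z A} {x' : A' ⟶ B'} {y' : B' ⟶ Z'}
    {δ' : T.Ext Z' A'} (h : T.IsTriangle x y δ) (a : A ≅ A') (b : B ≅ B') (c : Z ≅ Z')
    (H : T.IsTriangleHom x y δ x' y' δ' a.hom b.hom c.hom) : T.IsTriangle x' y' δ' := by
  obtain ⟨B₁, x₁, y₁, h₁⟩ := exists_isTriangle δ'
  obtain ⟨b', H'⟩ := hT.exists_isTriangleHom h h₁ a.hom c.hom H.2.2
  have := (hT.isHomExact h).isIso_mid (hT.isHomExact h₁) H'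
  refine h₁.of_iso_mid ((asIso b').symm ≪≫ b) ?_ ?_
  · rw [← cancel_epi a.hom, ← H.1, ← reassoc_of% H'.1]
    simp
  · rw [← cancel_epi b']
    simp [← H.2.1, ← H'.2.1]

end ExactTriangles

section Localization

variable {C : Type u} [Category.{v} C] [Preadditive C] (T : ExtTriple.{w} C)
  (S : MorphismProperty C)
  [S.HasLeftCalculusOfFractions] [S.HasRightCalculusOfFractions]

/-- The triangles of the localization: those that are isomorphic to the image under `Q` of a
triangle. -/
def IsLocTriangle {A B Z : S.Localization} (x : A ⟶ B) (y : B ⟶ Z)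
    (e : ((T.locE S).obj (op Z)).obj A) : Prop :=
  ∃ (A₀ B₀ Z₀ : C) (x₀ : A₀ ⟶ B₀) (y₀ : B₀ ⟶ Z₀) (δ : T.Ext Z₀ A₀) (a : S.Q.obj A₀ ≅ A)
    (b : S.Q.obj B₀ ≅ B) (c : S.Q.obj Z₀ ≅ Z), T.IsTriangle x₀ y₀ δ ∧
    S.Q.map x₀ ≫ b.hom = a.hom ≫ x ∧ S.Q.map y₀ ≫ c.hom = b.hom ≫ y ∧
    biPush (T.locE S) _ a.hom (T.locMu S Z₀ A₀ δ) = biPull (T.locE S) c.hom _ e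

lemma exists_isLocTriangle {A Z : S.Localization} (e : ((T.locE S).obj (op Z)).obj A) :
    ∃ σ : ShortSeq A Z, T.IsLocTriangle S σ.inc σ.proj e := by
  obtain ⟨Z₀, A₀, c, a, δ, h⟩ := T.exists_rep_locE S e
  obtain ⟨B₀, x₀, y₀, h₀⟩ := exists_isTriangle δ
  exact ⟨⟨S.Q.obj B₀, a.inv ≫ S.Q.map x₀, S.Q.map y₀ ≫ c.hom⟩, A₀, B₀, Z₀, x₀, y₀, δ, a,
    Iso.refl _, c, h₀, by simp, by simp, h⟩

/-- The localization of `T`: its extensions are the left Kan extension of those of `T`, and its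
realization chooses for each extension a sequence that is isomorphic to the image of a triangle.
Under the assumption `T.LiftsToTriangles S` below, the choice is unique up to equivalence. -/
noncomputable def loc : ExtTriple.{max u v w} S.Localization where
  E := T.locE S
  additive_left := ⟨fun {_ _ f g} => by
    ext Y e
    exact T.biPull_locE_add S f.unop g.unop e⟩
  additive_right _ := ⟨fun {_ _ f g} => by
    ext e
    exact T.biPush_locE_add S f g e⟩
  s e := Quotient.mk _ (T.exists_isLocTriangle S e).choose

/-- The comparison `E(Z, A) → Ẽ(QZ, QA)`. -/
noncomputable def mu (Z A : C) : T.Ext Z A →+ (T.loc S).Ext (S.Q.obj Z) (S.Q.obj A) :=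
  T.locMu S Z A

lemma mu_push (Z : C) {A A' : C} (a : A ⟶ A') (δ : T.Ext Z A) :
    T.mu S Z A' (T.push Z a δ) = (T.loc S).push _ (S.Q.map a) (T.mu S Z A δ) :=
  T.locMu_push S Z a δ

lemma mu_pull {Z' Z : C} (c : Z' ⟶ Z) (A : C) (δ : T.Ext Z A) :
    T.mu S Z' A (T.pull c A δ) = (T.loc S).pull (S.Q.map c) _ (T.mu S Z A δ) :=
  T.locMu_pull S c A δ

variable {T S}

lemma exists_rep_loc {X Y : S.Localization} (e : (T.loc S).Ext X Y) :
    ∃ (Z A : C) (c : S.Q.obj Z ≅ X) (a : S.Q.obj A ≅ Y) (δ : T.Ext Z A),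
      (T.loc S).push _ a.hom (T.mu S Z A δ) = (T.loc S).pull c.hom _ e :=
  T.exists_rep_locE S e

lemma exists_of_mu_eq_zero {Z A : C} {δ : T.Ext Z A} (h : T.mu S Z A δ = 0) :
    ∃ (Z' A' : C) (s : Z' ⟶ Z) (t : A ⟶ A'), S s ∧ S t ∧ T.push _ t (T.pull s A δ) = 0 :=
  T.exists_of_locMu_eq_zero S δ h

/-- A morphism between images of extensions comes, after composition with morphisms of `S`, from
a morphism of extensions. -/
lemma exists_push_eq_pull {Z A Z' A' : C} {δ : T.Ext Z A} {δ' : T.Ext Z' A'}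
    (α : S.Q.obj A ⟶ S.Q.obj A') (γ : S.Q.obj Z ⟶ S.Q.obj Z')
    (h : (T.loc S).push _ α (T.mu S Z A δ) = (T.loc S).pull γ _ (T.mu S Z' A' δ')) :
    ∃ (Z₁ A₁ : C) (s : Z₁ ⟶ Z) (c : Z₁ ⟶ Z') (t : A' ⟶ A₁) (a : A ⟶ A₁), S s ∧ S t ∧
      S.Q.map s ≫ γ = S.Q.map c ∧ α ≫ S.Q.map t = S.Q.map a ∧
      T.push Z₁ a (T.pull s A δ) = T.pull c A₁ (T.push Z' t δ') := by
  obtain ⟨A₁, a, t, ht, ha⟩ := S.exists_leftFraction_Q α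
  obtain ⟨Z₁, s, c, hs, hc⟩ := S.exists_rightFraction_Q γ
  have h' : T.mu S Z₁ A₁ (T.push Z₁ a (T.pull s A δ) - T.pull c A₁ (T.push Z' t δ')) = 0 := by
    rw [map_sub, sub_eq_zero, mu_push, mu_pull, push_pull, ← ha, push_comp, h, mu_pull, mu_push,
      ← hc, pull_comp, push_pull]
  obtain ⟨Z₂, A₂, s', t', hs', ht', h₂⟩ := exists_of_mu_eq_zero h'
  refine ⟨Z₂, A₂, s' ≫ s, s' ≫ c, t ≫ t', a ≫ t', S.comp_mem _ _ hs' hs, S.comp_mem _ _ ht ht',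
    by simp [hc], by simp [reassoc_of% ha], ?_⟩
  rw [map_sub, map_sub, sub_eq_zero] at h₂
  simp only [push_pull, push_comp, pull_comp] at h₂ ⊢
  exact h₂

end Localization

end ExtTriple

/-! ### Images of triangles under the localization functor -/

namespace ExtTriple

variable {C : Type u} [Category.{v} C] [Preadditive C]

/-- Morphisms of extensions whose end terms belong to `S` lift to morphisms of triangles whose
middle term belongs to `S`. -/
def LiftsToTriangles (T : ExtTriple.{w} C) (S : MorphismProperty C) : Prop :=
  ∀ ⦃A B Z A' B' Z' : C⦄ (x : A ⟶ B) (y : B ⟶ Z) (δ : T.Ext Z A)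
    (x' : A' ⟶ B') (y' : B' ⟶ Z') (δ' : T.Ext Z' A') (a : A ⟶ A') (c : Z ⟶ Z'),
    T.IsTriangle x y δ → T.IsTriangle x' y' δ' → T.push Z a δ = T.pull c A' δ' →
    S a → S c → ∃ b : B ⟶ B', S b ∧ T.IsTriangleHom x y δ x' y' δ' a b c

variable {T : ExtTriple.{w} C} {S : MorphismProperty C}
  [S.HasLeftCalculusOfFractions] [S.HasRightCalculusOfFractions]

/-- Calculus of fractions preserves the long exact sequences: a lifting problem in the localization
becomes, after multiplication by denominators, a lifting problem for a triangle obtained from the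
given one by moving an end term along a morphism of `S`; this triangle is identified with the given
one in the localization, because the morphism between the middle terms is in `S` as well. -/
lemma isHomExact_Q (hS : T.LiftsToTriangles S) {A B Z : C} {x : A ⟶ B} {y : B ⟶ Z}
    {δ : T.Ext Z A} (h : T.IsTriangle x y δ) (hE : ∀ {A B Z : C} {x : A ⟶ B} {y : B ⟶ Z}
      {δ : T.Ext Z A}, T.IsTriangle x y δ → T.IsHomExact x y δ) :
    (T.loc S).IsHomExact (S.Q.map x) (S.Q.map y) (T.mu S Z A δ) where
  comp_eq_zero := by rw [← S.Q.map_comp, (hE h).comp_eq_zero, S.Q.map_zero]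
  pull_proj := by rw [← mu_pull, (hE h).pull_proj, map_zero]
  push_inc := by rw [← mu_push, (hE h).push_inc, map_zero]
  lift_inc {X} g hg := by
    obtain ⟨X, rfl⟩ := S.Q_obj_surjective X
    obtain ⟨M, s, g', hs, hg'⟩ := S.exists_rightFraction_Q g
    obtain ⟨N, r, hr, fac⟩ := (MorphismProperty.map_eq_iff_precomp S.Q S (g' ≫ y) 0).1 (by
      rw [S.Q.map_comp, ← hg', Category.assoc, hg, comp_zero, S.Q.map_zero])
    obtain ⟨f, hf⟩ := (hE h).lift_inc (r ≫ g') (by simpa using fac)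
    have := Localization.inverts S.Q S _ (S.comp_mem _ _ hr hs)
    refine ⟨inv (S.Q.map (r ≫ s)) ≫ S.Q.map f, ?_⟩
    rw [Category.assoc, IsIso.inv_comp_eq, ← S.Q.map_comp, hf, S.Q.map_comp, S.Q.map_comp,
      Category.assoc, hg']
  lift_proj {X} k hk := by
    obtain ⟨X, rfl⟩ := S.Q_obj_surjective X
    obtain ⟨M, s, k', hs, hk'⟩ := S.exists_rightFraction_Q k
    obtain ⟨N, A', r, t, hr, ht, h₀⟩ := exists_of_mu_eq_zero (S := S) (δ := T.pull k' A δ) (by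
      rw [mu_pull, ← hk', pull_comp, hk, map_zero])
    obtain ⟨B', x', y', h'⟩ := exists_isTriangle (T.push Z t δ)
    obtain ⟨b, hb, -, hby, -⟩ := hS x y δ x' y' _ t (𝟙 Z) h h' (pull_id _ _ _ _).symm ht
      (S.id_mem Z)
    obtain ⟨g, hg⟩ := (hE h').lift_proj (r ≫ k') (by
      rw [← push_pull, pull_comp, h₀])
    have := Localization.inverts S.Q S _ (S.comp_mem _ _ hr hs)
    have := Localization.inverts S.Q S _ hb
    refine ⟨inv (S.Q.map (r ≫ s)) ≫ S.Q.map g ≫ inv (S.Q.map b), ?_⟩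
    have hby' : inv (S.Q.map b) ≫ S.Q.map y = S.Q.map y' := by
      rw [IsIso.inv_comp_eq, ← S.Q.map_comp, ← hby, Category.comp_id]
    rw [Category.assoc, Category.assoc, hby', IsIso.inv_comp_eq, ← S.Q.map_comp, hg,
      S.Q.map_comp, S.Q.map_comp, Category.assoc, hk']
  desc_proj {X} g hg := by
    obtain ⟨X, rfl⟩ := S.Q_obj_surjective X
    obtain ⟨M, g', t, ht, hg'⟩ := S.exists_leftFraction_Q g
    obtain ⟨N, r, hr, fac⟩ := (MorphismProperty.map_eq_iff_postcomp S.Q S (x ≫ g') 0).1 (by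
      rw [S.Q.map_comp, ← hg', reassoc_of% hg, zero_comp, S.Q.map_zero])
    obtain ⟨f, hf⟩ := (hE h).desc_proj (g' ≫ r) (by simpa using fac)
    have := Localization.inverts S.Q S _ (S.comp_mem _ _ ht hr)
    refine ⟨S.Q.map f ≫ inv (S.Q.map (t ≫ r)), ?_⟩
    rw [← Category.assoc, IsIso.comp_inv_eq, ← S.Q.map_comp, hf, S.Q.map_comp, S.Q.map_comp,
      ← Category.assoc, hg']
  desc_inc {X} k hk := by
    obtain ⟨X, rfl⟩ := S.Q_obj_surjective X
    obtain ⟨M, k', t, ht, hk'⟩ := S.exists_leftFraction_Q k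
    obtain ⟨Z', N, s, r, hs, hr, h₀⟩ := exists_of_mu_eq_zero (S := S) (δ := T.push Z k' δ) (by
      rw [mu_push, ← hk', push_comp, hk, map_zero])
    obtain ⟨B', x', y', h'⟩ := exists_isTriangle (T.pull s A δ)
    obtain ⟨b, hb, hbx, -, -⟩ := hS x' y' _ x y δ (𝟙 A) s h' h (push_id _ _ _ _)
      (S.id_mem A) hs
    obtain ⟨g, hg⟩ := (hE h').desc_inc (k' ≫ r) (by
      rw [push_comp, push_pull, h₀])
    have := Localization.inverts S.Q S _ (S.comp_mem _ _ ht hr)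
    have := Localization.inverts S.Q S _ hb
    refine ⟨inv (S.Q.map b) ≫ S.Q.map g ≫ inv (S.Q.map (t ≫ r)), ?_⟩
    have hbx' : S.Q.map x ≫ inv (S.Q.map b) = S.Q.map x' := by
      rw [IsIso.comp_inv_eq, ← S.Q.map_comp, hbx, Category.id_comp]
    rw [reassoc_of% hbx', ← Category.assoc, IsIso.comp_inv_eq, ← S.Q.map_comp, hg,
      S.Q.map_comp, S.Q.map_comp, ← Category.assoc, hk']

lemma IsLocTriangle.of_iso {A B Z A' B' Z' : S.Localization} {x : A ⟶ B} {y : B ⟶ Z}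
    {e : (T.loc S).Ext Z A} {x' : A' ⟶ B'} {y' : B' ⟶ Z'} {e' : (T.loc S).Ext Z' A'}
    (h : T.IsLocTriangle S x y e) (a : A ≅ A') (b : B ≅ B') (c : Z ≅ Z')
    (H : (T.loc S).IsTriangleHom x y e x' y' e' a.hom b.hom c.hom) :
    T.IsLocTriangle S x' y' e' := by
  obtain ⟨A₀, B₀, Z₀, x₀, y₀, δ, a₀, b₀, c₀, h₀, hx, hy, he⟩ := h
  replace he : (T.loc S).push _ a₀.hom (T.mu S _ _ δ) = (T.loc S).pull c₀.hom _ e := he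
  refine ⟨A₀, B₀, Z₀, x₀, y₀, δ, a₀ ≪≫ a, b₀ ≪≫ b, c₀ ≪≫ c, h₀, ?_, ?_, ?_⟩
  · simp [reassoc_of% hx, H.1]
  · simp [reassoc_of% hy, H.2.1]
  · change (T.loc S).push _ (a₀.hom ≫ a.hom) (T.mu S _ _ δ) =
      (T.loc S).pull (c₀.hom ≫ c.hom) _ e'
    rw [push_comp, he, push_pull, H.2.2, pull_comp]

section

variable [HasZeroObject C] [HasBinaryBiproducts C]

/-- A morphism of extensions between images of triangles is part of a morphism of triangles. -/
lemma exists_isTriangleHom_Q (hT : T.IsWeaklyExtriangulated) (hS : T.LiftsToTriangles S)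
    {A B Z A' B' Z' : C} {x : A ⟶ B} {y : B ⟶ Z} {δ : T.Ext Z A}
    {x' : A' ⟶ B'} {y' : B' ⟶ Z'} {δ' : T.Ext Z' A'} (h : T.IsTriangle x y δ)
    (h' : T.IsTriangle x' y' δ') (α : S.Q.obj A ⟶ S.Q.obj A') (γ : S.Q.obj Z ⟶ S.Q.obj Z')
    (H : (T.loc S).push _ α (T.mu S Z A δ) = (T.loc S).pull γ _ (T.mu S Z' A' δ')) :
    ∃ β : S.Q.obj B ⟶ S.Q.obj B', (T.loc S).IsTriangleHom (S.Q.map x) (S.Q.map y) (T.mu S Z A δ)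
      (S.Q.map x') (S.Q.map y') (T.mu S Z' A' δ') α β γ := by
  obtain ⟨Z₁, A₁, s, c, t, a, hs, ht, hc, ha, hca⟩ := exists_push_eq_pull α γ H
  obtain ⟨B₁, x₁, y₁, h₁⟩ := exists_isTriangle (T.pull s A δ)
  obtain ⟨B₂, x₂, y₂, h₂⟩ := exists_isTriangle (T.push Z' t δ')
  obtain ⟨b₁, hb₁, hx₁, hy₁, -⟩ := hS x₁ y₁ _ x y δ (𝟙 A) s h₁ h (push_id _ _ _ _)
    (S.id_mem A) hs
  obtain ⟨b₂, hb₂, hx₂, hy₂, -⟩ := hS x' y' δ' x₂ y₂ _ t (𝟙 Z') h' h₂ (pull_id _ _ _ _).symm ht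
    (S.id_mem Z')
  obtain ⟨b, hx, hy, -⟩ := hT.exists_isTriangleHom h₁ h₂ a c hca
  have := Localization.inverts S.Q S _ hs
  have := Localization.inverts S.Q S _ ht
  have := Localization.inverts S.Q S _ hb₁
  have := Localization.inverts S.Q S _ hb₂
  refine ⟨inv (S.Q.map b₁) ≫ S.Q.map b ≫ inv (S.Q.map b₂), ?_, ?_, H⟩
  · have hx₁' : S.Q.map x ≫ inv (S.Q.map b₁) = S.Q.map x₁ := by
      rw [IsIso.comp_inv_eq, ← S.Q.map_comp, hx₁, Category.id_comp]
    rw [reassoc_of% hx₁', ← Category.assoc, IsIso.comp_inv_eq, ← S.Q.map_comp, hx, S.Q.map_comp,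
      ← ha, Category.assoc, Category.assoc, ← S.Q.map_comp, ← S.Q.map_comp, hx₂]
  · have hy₂' : inv (S.Q.map b₂) ≫ S.Q.map y' = S.Q.map y₂ := by
      rw [IsIso.inv_comp_eq, ← S.Q.map_comp, ← hy₂, Category.comp_id]
    rw [Category.assoc, Category.assoc, hy₂', IsIso.eq_inv_comp, ← S.Q.map_comp, ← hy,
      S.Q.map_comp, ← hc, ← Category.assoc, ← S.Q.map_comp, ← hy₁, S.Q.map_comp, Category.assoc]

lemma IsLocTriangle.exists_iso (hT : T.IsWeaklyExtriangulated) (hS : T.LiftsToTriangles S)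
    {A B Z A' B' Z' : S.Localization} {x : A ⟶ B} {y : B ⟶ Z}
    {e : (T.loc S).Ext Z A} {x' : A' ⟶ B'} {y' : B' ⟶ Z'} {e' : (T.loc S).Ext Z' A'}
    (h : T.IsLocTriangle S x y e) (h' : T.IsLocTriangle S x' y' e') (a : A ≅ A') (c : Z ≅ Z')
    (H : (T.loc S).push _ a.hom e = (T.loc S).pull c.hom _ e') :
    ∃ b : B ≅ B', (T.loc S).IsTriangleHom x y e x' y' e' a.hom b.hom c.hom := by
  obtain ⟨A₀, B₀, Z₀, x₀, y₀, δ, a₀, b₀, c₀, h₀, hx, hy, he⟩ := h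
  obtain ⟨A₁, B₁, Z₁, x₁, y₁, δ', a₁, b₁, c₁, h₁, hx', hy', he'⟩ := h'
  replace he : (T.loc S).push _ a₀.hom (T.mu S _ _ δ) = (T.loc S).pull c₀.hom _ e := he
  replace he' : (T.loc S).push _ a₁.hom (T.mu S _ _ δ') = (T.loc S).pull c₁.hom _ e' := he'
  obtain ⟨β, hβ⟩ := exists_isTriangleHom_Q hT hS h₀ h₁ (a₀ ≪≫ a ≪≫ a₁.symm).hom
    (c₀ ≪≫ c ≪≫ c₁.symm).hom (by
      have he'' : T.mu S _ _ δ' = (T.loc S).push _ a₁.inv ((T.loc S).pull c₁.hom _ e') := by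
        rw [← he', push_hom_inv]
      simp only [Iso.trans_hom, Iso.symm_hom, push_comp, pull_comp]
      rw [he, push_pull, H, he'']
      simp only [push_pull, pull_inv_hom])
  have := (isHomExact_Q hS h₀ hT.isHomExact).isIso_mid (isHomExact_Q hS h₁ hT.isHomExact) hβ
  obtain ⟨hβx, hβy, -⟩ := hβ
  refine ⟨b₀.symm ≪≫ asIso β ≪≫ b₁, ?_, ?_, H⟩
  · rw [← cancel_epi a₀.hom, ← reassoc_of% hx]
    simp [reassoc_of% hβx, hx']
  · rw [← cancel_epi b₀.hom, ← reassoc_of% hy]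
    simp only [Iso.trans_hom, Iso.symm_hom, asIso_hom, Category.assoc, Iso.hom_inv_id_assoc,
      ← hy', ← reassoc_of% hβy]
    simp

lemma isTriangle_loc_iff (hT : T.IsWeaklyExtriangulated) (hS : T.LiftsToTriangles S)
    {A B Z : S.Localization} {x : A ⟶ B} {y : B ⟶ Z} {e : (T.loc S).Ext Z A} :
    (T.loc S).IsTriangle x y e ↔ T.IsLocTriangle S x y e := by
  have h₀ := (T.exists_isLocTriangle S e).choose_spec
  have h₁ : (T.loc S).IsTriangle (T.exists_isLocTriangle S e).choose.inc
    (T.exists_isLocTriangle S e).choose.proj e := rfl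
  constructor
  · intro h
    obtain ⟨b, hx, hy⟩ := h₁.exists_iso_mid h
    exact h₀.of_iso (Iso.refl _) b (Iso.refl _) ⟨by simp [hx], by simp [hy], by
      simp [push_id, pull_id]⟩
  · intro h
    obtain ⟨b, hx, hy, -⟩ := h₀.exists_iso hT hS h (Iso.refl _) (Iso.refl _) (by
      simp [push_id, pull_id])
    exact h₁.of_iso_mid b (by simpa using hx) (by simpa using hy.symm)

end

end ExtTriple

/-! ### The localization is weakly extriangulated -/

namespace ExtTriple

variable {C : Type u} [Category.{v} C] [Preadditive C] [HasBinaryBiproducts C]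

instance (S : MorphismProperty C) [S.HasLeftCalculusOfFractions] :
    PreservesBinaryBiproducts S.Q :=
  preservesBinaryBiproducts_of_preservesBinaryProducts S.Q

lemma hasBinaryBiproducts_localization (S : MorphismProperty C) [S.HasLeftCalculusOfFractions] :
    HasBinaryBiproducts S.Localization where
  has_binary_biproduct X Y := by
    obtain ⟨X, rfl⟩ := S.Q_obj_surjective X
    obtain ⟨Y, rfl⟩ := S.Q_obj_surjective Y
    exact S.Q.hasBinaryBiproduct_of_preserves X Y

/-- The comparison isomorphism between the image of a biproduct and the biproduct of two objects
isomorphic to the images. -/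
@[simps]
noncomputable def biprodIsoQ {S : MorphismProperty C} [S.HasLeftCalculusOfFractions]
    [HasBinaryBiproducts S.Localization] {X Y : C} {X' Y' : S.Localization}
    (f : S.Q.obj X ≅ X') (g : S.Q.obj Y ≅ Y') : S.Q.obj (X ⊞ Y) ≅ X' ⊞ Y' where
  hom := biprod.lift (S.Q.map biprod.fst ≫ f.hom) (S.Q.map biprod.snd ≫ g.hom)
  inv := biprod.desc (f.inv ≫ S.Q.map biprod.inl) (g.inv ≫ S.Q.map biprod.inr)
  hom_inv_id := by
    rw [biprod.lift_desc]
    simp only [Category.assoc, Iso.hom_inv_id_assoc, ← S.Q.map_comp, ← S.Q.map_add,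
      biprod.total, S.Q.map_id]
  inv_hom_id := by
    have h₁ : S.Q.map (biprod.inl : X ⟶ X ⊞ Y) ≫ S.Q.map biprod.fst = 𝟙 _ := by
      rw [← S.Q.map_comp, biprod.inl_fst, S.Q.map_id]
    have h₂ : S.Q.map (biprod.inl : X ⟶ X ⊞ Y) ≫ S.Q.map biprod.snd = 0 := by
      rw [← S.Q.map_comp, biprod.inl_snd, S.Q.map_zero]
    have h₃ : S.Q.map (biprod.inr : Y ⟶ X ⊞ Y) ≫ S.Q.map biprod.fst = 0 := by
      rw [← S.Q.map_comp, biprod.inr_fst, S.Q.map_zero]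
    have h₄ : S.Q.map (biprod.inr : Y ⟶ X ⊞ Y) ≫ S.Q.map biprod.snd = 𝟙 _ := by
      rw [← S.Q.map_comp, biprod.inr_snd, S.Q.map_id]
    ext <;> simp [reassoc_of% h₁, reassoc_of% h₂, reassoc_of% h₃, reassoc_of% h₄]

variable [HasZeroObject C] {T : ExtTriple.{w} C} {S : MorphismProperty C}
  [S.HasLeftCalculusOfFractions] [S.HasRightCalculusOfFractions]

lemma IsTriangle.map_Q (hT : T.IsWeaklyExtriangulated) (hS : T.LiftsToTriangles S) {A B Z : C}
    {x : A ⟶ B} {y : B ⟶ Z} {δ : T.Ext Z A} (h : T.IsTriangle x y δ) :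
    (T.loc S).IsTriangle (S.Q.map x) (S.Q.map y) (T.mu S Z A δ) :=
  (isTriangle_loc_iff hT hS).2 ⟨A, B, Z, x, y, δ, Iso.refl _, Iso.refl _, Iso.refl _, h, by simp,
    by simp, (biPush_id _ _ _ _).trans (biPull_id _ _ _ _).symm⟩

/-- Every triangle of the localization is isomorphic to the image of a triangle. -/
lemma IsTriangle.exists_iso_map_Q (hT : T.IsWeaklyExtriangulated) (hS : T.LiftsToTriangles S)
    {A B Z : S.Localization} {x : A ⟶ B} {y : B ⟶ Z} {e : (T.loc S).Ext Z A}
    (h : (T.loc S).IsTriangle x y e) :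
    ∃ (A₀ B₀ Z₀ : C) (x₀ : A₀ ⟶ B₀) (y₀ : B₀ ⟶ Z₀) (δ : T.Ext Z₀ A₀) (a : S.Q.obj A₀ ≅ A)
      (b : S.Q.obj B₀ ≅ B) (c : S.Q.obj Z₀ ≅ Z), T.IsTriangle x₀ y₀ δ ∧
      (T.loc S).IsTriangleHom (S.Q.map x₀) (S.Q.map y₀) (T.mu S Z₀ A₀ δ) x y e
        a.hom b.hom c.hom :=
  (isTriangle_loc_iff hT hS).1 h

lemma IsTriangle.loc_of_iso (hT : T.IsWeaklyExtriangulated) (hS : T.LiftsToTriangles S)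
    {A B Z A' B' Z' : S.Localization} {x : A ⟶ B} {y : B ⟶ Z}
    {e : (T.loc S).Ext Z A} {x' : A' ⟶ B'} {y' : B' ⟶ Z'} {e' : (T.loc S).Ext Z' A'}
    (h : (T.loc S).IsTriangle x y e) (a : A ≅ A') (b : B ≅ B') (c : Z ≅ Z')
    (H : (T.loc S).IsTriangleHom x y e x' y' e' a.hom b.hom c.hom) :
    (T.loc S).IsTriangle x' y' e' :=
  (isTriangle_loc_iff hT hS).2 (((isTriangle_loc_iff hT hS).1 h).of_iso a b c H)

lemma IsTriangle.loc_exists_iso (hT : T.IsWeaklyExtriangulated) (hS : T.LiftsToTriangles S)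
    {A B Z A' B' Z' : S.Localization} {x : A ⟶ B} {y : B ⟶ Z}
    {e : (T.loc S).Ext Z A} {x' : A' ⟶ B'} {y' : B' ⟶ Z'} {e' : (T.loc S).Ext Z' A'}
    (h : (T.loc S).IsTriangle x y e) (h' : (T.loc S).IsTriangle x' y' e') (a : A ≅ A')
    (c : Z ≅ Z') (H : (T.loc S).push _ a.hom e = (T.loc S).pull c.hom _ e') :
    ∃ b : B ≅ B', (T.loc S).IsTriangleHom x y e x' y' e' a.hom b.hom c.hom :=
  ((isTriangle_loc_iff hT hS).1 h).exists_iso hT hS ((isTriangle_loc_iff hT hS).1 h') a c H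

lemma isHomExact_loc (hT : T.IsWeaklyExtriangulated) (hS : T.LiftsToTriangles S)
    {A B Z : S.Localization} {x : A ⟶ B} {y : B ⟶ Z} {e : (T.loc S).Ext Z A}
    (h : (T.loc S).IsTriangle x y e) : (T.loc S).IsHomExact x y e := by
  obtain ⟨A₀, B₀, Z₀, x₀, y₀, δ, a, b, c, h₀, H⟩ := h.exists_iso_map_Q hT hS
  exact (isHomExact_Q hS h₀ hT.isHomExact).of_iso a b c H

/-- Replacing `A'` by an isomorphic object, `a` becomes the image of a morphism of `C`, so that the
axiom for `T` applies. -/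
lemma loc_c3 (hT : T.IsWeaklyExtriangulated) (hS : T.LiftsToTriangles S)
    [HasBinaryBiproducts S.Localization]
    {A B Z A' B' : S.Localization} (x : A ⟶ B) (y : B ⟶ Z) (e : (T.loc S).Ext Z A) (a : A ⟶ A')
    (x' : A' ⟶ B') (y' : B' ⟶ Z) (h : (T.loc S).IsTriangle x y e)
    (h' : (T.loc S).IsTriangle x' y' ((T.loc S).push Z a e)) :
    ∃ b : B ⟶ B', (T.loc S).IsTriangleHom x y e x' y' ((T.loc S).push Z a e) a b (𝟙 Z) ∧
      (T.loc S).IsTriangle (biprod.lift x a) (biprod.desc b (-x')) ((T.loc S).pull y' A e) := by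
  obtain ⟨A₀, B₀, Z₀, x₀, y₀, δ, a₀, b₀, c₀, h₀, hx, hy, he⟩ := h.exists_iso_map_Q hT hS
  obtain ⟨A', rfl⟩ := S.Q_obj_surjective A'
  obtain ⟨A₁, α, t, ht, hα⟩ := S.exists_leftFraction_Q (a₀.hom ≫ a)
  have := Localization.inverts S.Q S _ ht
  let a₁ : S.Q.obj A₁ ≅ S.Q.obj A' := (asIso (S.Q.map t)).symm
  replace hα : S.Q.map α ≫ a₁.hom = a₀.hom ≫ a := by simp [a₁, ← hα]
  obtain ⟨B₁, x₁, y₁, h₁⟩ := exists_isTriangle (T.push Z₀ α δ)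
  obtain ⟨β, ⟨hβx, hβy, -⟩, hβ⟩ := hT.c3 x₀ y₀ δ α x₁ y₁ h₀ h₁
  obtain ⟨b₁, hx₁, hy₁, -⟩ := (h₁.map_Q hT hS).loc_exists_iso hT hS h' a₁ c₀ (by
    rw [mu_push, ← push_comp, hα, push_comp, he, push_pull])
  refine ⟨b₀.inv ≫ S.Q.map β ≫ b₁.hom, ⟨?_, ?_, (pull_id _ _ _ _).symm⟩,
    (hβ.map_Q hT hS).loc_of_iso hT hS a₀ (biprodIsoQ b₀ a₁) b₁
      ⟨?_, ?_, ?_⟩⟩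
  · rw [← cancel_epi a₀.hom, ← reassoc_of% hx, b₀.hom_inv_id_assoc, ← S.Q.map_comp_assoc, hβx,
      S.Q.map_comp_assoc, hx₁, reassoc_of% hα]
  · rw [← cancel_epi b₀.hom, Category.comp_id, ← hy, Category.assoc, Category.assoc,
      b₀.hom_inv_id_assoc, ← hy₁, ← S.Q.map_comp_assoc, ← hβy, Category.comp_id]
  · ext <;> simp [← S.Q.map_comp_assoc, hx, hα]
  · simp [biprod.desc_eq, hx₁]
  · rw [mu_pull, push_pull, he, ← pull_comp, hy₁, pull_comp]

lemma loc_c3' (hT : T.IsWeaklyExtriangulated) (hS : T.LiftsToTriangles S)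
    [HasBinaryBiproducts S.Localization]
    {A B Z Z' B' : S.Localization} (x : A ⟶ B) (y : B ⟶ Z) (e : (T.loc S).Ext Z A) (c : Z' ⟶ Z)
    (x' : A ⟶ B') (y' : B' ⟶ Z') (h : (T.loc S).IsTriangle x y e)
    (h' : (T.loc S).IsTriangle x' y' ((T.loc S).pull c A e)) :
    ∃ b : B' ⟶ B, (T.loc S).IsTriangleHom x' y' ((T.loc S).pull c A e) x y e (𝟙 A) b c ∧
      (T.loc S).IsTriangle (biprod.lift (-y') b) (biprod.desc c y) ((T.loc S).push Z x' e) := by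
  obtain ⟨A₀, B₀, Z₀, x₀, y₀, δ, a₀, b₀, c₀, h₀, hx, hy, he⟩ := h.exists_iso_map_Q hT hS
  obtain ⟨Z', rfl⟩ := S.Q_obj_surjective Z'
  obtain ⟨Z₁, s, γ, hs, hγ⟩ := S.exists_rightFraction_Q (c ≫ c₀.inv)
  have := Localization.inverts S.Q S _ hs
  let c₁ : S.Q.obj Z₁ ≅ S.Q.obj Z' := asIso (S.Q.map s)
  replace hγ : S.Q.map γ ≫ c₀.hom = c₁.hom ≫ c := by simp [c₁, ← hγ]
  obtain ⟨B₁, x₁, y₁, h₁⟩ := exists_isTriangle (T.pull γ A₀ δ)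
  obtain ⟨β, ⟨hβx, hβy, -⟩, hβ⟩ := hT.c3' x₀ y₀ δ γ x₁ y₁ h₀ h₁
  obtain ⟨b₁, hx₁, hy₁, -⟩ := (h₁.map_Q hT hS).loc_exists_iso hT hS h' a₀ c₁ (by
    rw [mu_pull, push_pull, he, ← pull_comp, hγ, pull_comp])
  refine ⟨b₁.inv ≫ S.Q.map β ≫ b₀.hom, ⟨?_, ?_, push_id _ _ _ _⟩,
    (hβ.map_Q hT hS).loc_of_iso hT hS b₁ (biprodIsoQ c₁ b₀) c₀
      ⟨?_, ?_, ?_⟩⟩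
  · rw [← cancel_epi a₀.hom, ← reassoc_of% hx₁, b₁.hom_inv_id_assoc, ← S.Q.map_comp_assoc, hβx,
      Category.id_comp, Category.id_comp, hx]
  · rw [← cancel_epi b₁.hom, ← reassoc_of% hy₁, Category.assoc, Category.assoc,
      b₁.hom_inv_id_assoc, ← hγ, ← hy, ← S.Q.map_comp_assoc, ← S.Q.map_comp_assoc, hβy]
  · ext <;> simp [← S.Q.map_comp_assoc, hy₁]
  · simp [biprod.desc_eq, hy, hγ]
  · rw [mu_push, ← push_comp, hx₁, push_comp, he, push_pull]

lemma isWeaklyExtriangulated_loc (hT : T.IsWeaklyExtriangulated) (hS : T.LiftsToTriangles S)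
    [HasBinaryBiproducts S.Localization] : (T.loc S).IsWeaklyExtriangulated where
  c1 x y e h := (isHomExact_loc hT hS h).exact
  c1' x y e h := (isHomExact_loc hT hS h).exact'
  c2 A := by
    obtain ⟨A, rfl⟩ := S.Q_obj_surjective A
    exact ((hT.c2 A).map_Q hT hS).loc_of_iso hT hS (Iso.refl _) (Iso.refl _) S.Q.mapZeroObject
      ⟨by simp, by simp, by simp⟩
  c2' A := by
    obtain ⟨A, rfl⟩ := S.Q_obj_surjective A
    exact ((hT.c2' A).map_Q hT hS).loc_of_iso hT hS S.Q.mapZeroObject (Iso.refl _) (Iso.refl _)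
      ⟨by simp, by simp, by simp⟩
  c3 x y e a x' y' h h' := loc_c3 hT hS x y e a x' y' h h'
  c3' x y e c x' y' h h' := loc_c3' hT hS x y e c x' y' h h'

end ExtTriple

/-! ### The universal property -/

namespace ExtTriple

section Descent

variable {C : Type u} [Category.{v} C] [Preadditive C] {T : ExtTriple.{w} C}
  {S : MorphismProperty C} [S.HasLeftCalculusOfFractions] [S.HasRightCalculusOfFractions]

/-- Two extensions with the same end terms have representatives with the same end terms. -/
lemma exists_rep_loc₂ {X Y : S.Localization} (e₁ e₂ : (T.loc S).Ext X Y) :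
    ∃ (Z A : C) (c : S.Q.obj Z ≅ X) (a : S.Q.obj A ≅ Y) (δ₁ δ₂ : T.Ext Z A),
      (T.loc S).push _ a.hom (T.mu S Z A δ₁) = (T.loc S).pull c.hom _ e₁ ∧
      (T.loc S).push _ a.hom (T.mu S Z A δ₂) = (T.loc S).pull c.hom _ e₂ := by
  obtain ⟨Z₁, A₁, c₁, a₁, δ₁, h₁⟩ := exists_rep_loc e₁
  obtain ⟨Z₂, A₂, c₂, a₂, δ₂, h₂⟩ := exists_rep_loc e₂
  obtain ⟨A, α, t, ht, hα⟩ := S.exists_leftFraction_Q (a₂.hom ≫ a₁.inv)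
  obtain ⟨Z, s, γ, hs, hγ⟩ := S.exists_rightFraction_Q (c₁.hom ≫ c₂.inv)
  have := Localization.inverts S.Q S _ hs
  have := Localization.inverts S.Q S _ ht
  refine ⟨Z, A, asIso (S.Q.map s) ≪≫ c₁, (asIso (S.Q.map t)).symm ≪≫ a₁,
    T.pull s _ (T.push _ t δ₁), T.pull γ _ (T.push _ α δ₂), ?_, ?_⟩
  · rw [mu_pull, mu_push, push_pull, ← push_comp]
    simp [pull_comp, h₁]
  · have hα' : S.Q.map α ≫ inv (S.Q.map t) ≫ a₁.hom = a₂.hom := by simp [← hα]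
    have hγ' : S.Q.map γ ≫ c₂.hom = S.Q.map s ≫ c₁.hom := by simp [← hγ]
    rw [mu_pull, mu_push, push_pull, ← push_comp]
    simp only [Iso.trans_hom, Iso.symm_hom, asIso_inv, asIso_hom]
    rw [hα', h₂, ← pull_comp, hγ']

variable {D : Type u'} [Category.{v'} D] [Preadditive D] {T' : ExtTriple.{w'} D}
  {G : S.Localization ⥤ D}
  {φ : ∀ Z A : C, T.Ext Z A →+ T'.Ext (G.obj (S.Q.obj Z)) (G.obj (S.Q.obj A))}
  (φ_push : ∀ (Z : C) {A A' : C} (a : A ⟶ A') (δ : T.Ext Z A),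
    φ Z A' (T.push Z a δ) = T'.push _ (G.map (S.Q.map a)) (φ Z A δ))
  (φ_pull : ∀ {Z' Z : C} (c : Z' ⟶ Z) (A : C) (δ : T.Ext Z A),
    φ Z' A (T.pull c A δ) = T'.pull (G.map (S.Q.map c)) _ (φ Z A δ))

section

include φ_push φ_pull

lemma push_eq_pull_of_mu {Z A Z' A' : C} {δ : T.Ext Z A} {δ' : T.Ext Z' A'}
    {α : S.Q.obj A ⟶ S.Q.obj A'} {γ : S.Q.obj Z ⟶ S.Q.obj Z'}
    (h : (T.loc S).push _ α (T.mu S Z A δ) = (T.loc S).pull γ _ (T.mu S Z' A' δ')) :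
    T'.push _ (G.map α) (φ Z A δ) = T'.pull (G.map γ) _ (φ Z' A' δ') := by
  obtain ⟨Z₁, A₁, s, c, t, a, hs, ht, hc, ha, hca⟩ := exists_push_eq_pull α γ h
  have := Localization.inverts S.Q S _ hs
  have := Localization.inverts S.Q S _ ht
  apply T'.push_injective (G.map (S.Q.map t))
  apply T'.pull_injective (G.map (S.Q.map s))
  have hca' := congrArg (φ Z₁ A₁) hca
  simp only [φ_push, φ_pull, ← ha, ← hc, Functor.map_comp, push_comp, pull_comp] at hca'
  simpa only [push_pull] using hca'

/-- The morphisms `c` and `a` are not required to be isomorphisms; this makes the compatibility of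
the induced map with `push` and `pull` immediate. -/
lemma exists_descent {X Y : S.Localization} (e : (T.loc S).Ext X Y) :
    ∃ ε : T'.Ext (G.obj X) (G.obj Y), ∀ (Z A : C) (c : S.Q.obj Z ⟶ X) (a : S.Q.obj A ⟶ Y)
      (δ : T.Ext Z A), (T.loc S).push _ a (T.mu S Z A δ) = (T.loc S).pull c _ e →
      T'.push _ (G.map a) (φ Z A δ) = T'.pull (G.map c) _ ε := by
  obtain ⟨Z₀, A₀, c₀, a₀, δ₀, h₀⟩ := exists_rep_loc e
  refine ⟨T'.pull (G.map c₀.inv) _ (T'.push _ (G.map a₀.hom) (φ Z₀ A₀ δ₀)),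
    fun Z A c a δ h => ?_⟩
  have h' := push_eq_pull_of_mu φ_push φ_pull (δ := δ) (δ' := δ₀) (α := a ≫ a₀.inv)
    (γ := c ≫ c₀.inv) (by
      have he : e = (T.loc S).pull c₀.inv _ ((T.loc S).push _ a₀.hom (T.mu S _ _ δ₀)) := by
        rw [h₀, pull_inv_hom]
      rw [push_comp, h, he, pull_comp, push_pull, push_pull, push_hom_inv])
  have h'' := congrArg (T'.push _ (G.map a₀.hom)) h'
  rw [← push_comp, ← G.map_comp, Category.assoc, a₀.inv_hom_id, Category.comp_id, G.map_comp,
    pull_comp, push_pull, push_pull] at h''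
  exact h''

end

/-- The map on extensions of the localization induced by `φ`, characterized by `descent_spec`. -/
noncomputable def descent (X Y : S.Localization) :
    (T.loc S).Ext X Y →+ T'.Ext (G.obj X) (G.obj Y) :=
  AddMonoidHom.mk' (fun e => (exists_descent φ_push φ_pull e).choose) (fun e₁ e₂ => by
    obtain ⟨Z, A, c, a, δ₁, δ₂, h₁, h₂⟩ := exists_rep_loc₂ e₁ e₂
    apply T'.pull_injective (G.map c.hom)
    rw [map_add, ← (exists_descent φ_push φ_pull e₁).choose_spec Z A c.hom a.hom δ₁ h₁,
      ← (exists_descent φ_push φ_pull e₂).choose_spec Z A c.hom a.hom δ₂ h₂,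
      ← (exists_descent φ_push φ_pull (e₁ + e₂)).choose_spec Z A c.hom a.hom (δ₁ + δ₂) (by
        simp only [map_add, h₁, h₂]), map_add, map_add])

lemma descent_spec {X Y : S.Localization} (e : (T.loc S).Ext X Y) {Z A : C}
    (c : S.Q.obj Z ⟶ X) (a : S.Q.obj A ⟶ Y) (δ : T.Ext Z A)
    (h : (T.loc S).push _ a (T.mu S Z A δ) = (T.loc S).pull c _ e) :
    T'.push _ (G.map a) (φ Z A δ) = T'.pull (G.map c) _ (descent φ_push φ_pull X Y e) :=
  (exists_descent φ_push φ_pull e).choose_spec Z A c a δ h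

lemma descent_mu {Z A : C} (δ : T.Ext Z A) :
    descent φ_push φ_pull _ _ (T.mu S Z A δ) = φ Z A δ := by
  have h := descent_spec φ_push φ_pull (T.mu S Z A δ) (𝟙 _) (𝟙 _) δ (by rw [push_id, pull_id])
  rw [G.map_id, G.map_id, push_id, pull_id] at h
  exact h.symm

lemma descent_push (X : S.Localization) {Y Y' : S.Localization} (f : Y ⟶ Y')
    (e : (T.loc S).Ext X Y) :
    descent φ_push φ_pull X Y' ((T.loc S).push X f e) =
      T'.push _ (G.map f) (descent φ_push φ_pull X Y e) := by
  obtain ⟨Z, A, c, a, δ, h⟩ := exists_rep_loc e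
  apply T'.pull_injective (G.map c.hom)
  rw [← descent_spec φ_push φ_pull ((T.loc S).push X f e) c.hom (a.hom ≫ f) δ
    (by rw [push_comp, h, push_pull]), ← push_pull, ← descent_spec φ_push φ_pull e c.hom a.hom δ h,
    G.map_comp, push_comp]

lemma descent_pull {X' X : S.Localization} (f : X' ⟶ X) (Y : S.Localization)
    (e : (T.loc S).Ext X Y) :
    descent φ_push φ_pull X' Y ((T.loc S).pull f Y e) =
      T'.pull (G.map f) _ (descent φ_push φ_pull X Y e) := by
  obtain ⟨Z, A, c, a, δ, h⟩ := exists_rep_loc ((T.loc S).pull f Y e)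
  apply T'.pull_injective (G.map c.hom)
  rw [← descent_spec φ_push φ_pull _ c.hom a.hom δ h, ← pull_comp, ← G.map_comp,
    ← descent_spec φ_push φ_pull e (c.hom ≫ f) a.hom δ (by rw [h, pull_comp])]

end Descent

section UniversalProperty

variable {C : Type u} [Category.{v} C] [Preadditive C] [HasZeroObject C] [HasBinaryBiproducts C]
  {T : ExtTriple.{w} C} {S : MorphismProperty C}
  [S.HasLeftCalculusOfFractions] [S.HasRightCalculusOfFractions]

/-- The localization functor as an exact functor. -/
noncomputable def toLoc (hT : T.IsWeaklyExtriangulated) (hS : T.LiftsToTriangles S) :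
    ExtExactFunctor T (T.loc S) where
  F := S.Q
  additive := inferInstance
  φ := T.mu S
  φ_push := T.mu_push S
  φ_pull := T.mu_pull S
  map_triangle _ _ _ h := h.map_Q hT hS

variable {D : Type u'} [Category.{v'} D] [Preadditive D] {T' : ExtTriple.{w'} D}

lemma exists_toLoc_comp_eq [HasZeroObject D] [HasBinaryBiproducts D]
    (hT : T.IsWeaklyExtriangulated) (hS : T.LiftsToTriangles S)
    (hT' : T'.IsWeaklyExtriangulated) (P : ExtExactFunctor T T') (hP : S.IsInvertedBy P.F) :
    ∃ P' : ExtExactFunctor (T.loc S) T', (toLoc hT hS).comp P' = P := by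
  obtain ⟨F, hF, φ, φ_push, φ_pull, map_triangle⟩ := P
  obtain ⟨G, rfl⟩ : ∃ G, S.Q ⋙ G = F := ⟨_, Localization.Construction.fac F hP⟩
  let P' : ExtExactFunctor (T.loc S) T' :=
    { F := G
      additive := (Localization.functor_additive_iff S.Q S G).2 hF
      φ := descent (φ := φ) φ_push φ_pull
      φ_push := descent_push (φ := φ) φ_push φ_pull
      φ_pull := descent_pull (φ := φ) φ_push φ_pull
      map_triangle := fun x y e h => by
        obtain ⟨A₀, B₀, Z₀, x₀, y₀, δ, a, b, c, h₀, hx, hy, he⟩ := h.exists_iso_map_Q hT hS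
        refine hT'.isTriangle_of_iso (map_triangle x₀ y₀ δ h₀) (G.mapIso a) (G.mapIso b)
          (G.mapIso c) ⟨?_, ?_, descent_spec (φ := φ) φ_push φ_pull e c.hom a.hom δ he⟩
        · simp only [Functor.comp_map, Functor.mapIso_hom, ← G.map_comp, hx]
        · simp only [Functor.comp_map, Functor.mapIso_hom, ← G.map_comp, hy] }
  refine ⟨P', ?_⟩
  have h : ((toLoc hT hS).comp P').φ = φ := by
    ext Z A δ
    exact descent_mu (φ := φ) φ_push φ_pull δ
  exact (ExtExactFunctor.mk.injEq ..).mpr ⟨rfl, heq_of_eq h⟩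

lemma toLoc_comp_injective (hT : T.IsWeaklyExtriangulated) (hS : T.LiftsToTriangles S)
    {P R : ExtExactFunctor (T.loc S) T'} (h : (toLoc hT hS).comp P = (toLoc hT hS).comp R) :
    P = R := by
  obtain ⟨F, hF, φ, φ_push, φ_pull, map_triangle⟩ := P
  obtain ⟨F', hF', φ', φ_push', φ_pull', map_triangle'⟩ := R
  obtain rfl : F = F' := Localization.Construction.uniq _ _ (congrArg ExtExactFunctor.F h)
  have hφ := eq_of_heq ((ExtExactFunctor.mk.injEq ..).mp h).2
  obtain rfl : φ = φ' := by
    ext X Y e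
    obtain ⟨Z, A, c, a, δ, he⟩ := exists_rep_loc e
    apply T'.pull_injective (F.map c.hom)
    rw [← φ_pull, ← φ_pull', ← he, φ_push, φ_push']
    exact congrArg _ (DFunLike.congr_fun (congrFun (congrFun hφ Z) A) δ)
  rfl

lemma existsUnique_whiskerLeft_toLoc (hT : T.IsWeaklyExtriangulated) (hS : T.LiftsToTriangles S)
    (P R : ExtExactFunctor (T.loc S) T')
    (η : ((toLoc hT hS).comp P).Hom ((toLoc hT hS).comp R)) :
    ∃! η' : P.Hom R, ExtExactFunctor.Hom.whiskerLeft (toLoc hT hS) η' = η := by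
  let τ : P.F ⟶ R.F := Localization.Construction.natTransExtension η.η
  have hτ (X : C) : τ.app (S.Q.obj X) = η.η.app X :=
    NatTrans.congr_app (Localization.Construction.whiskerLeft_natTransExtension η.η) X
  refine ⟨⟨τ, fun {X Y} e => ?_⟩, ExtExactFunctor.Hom.ext (by
    ext X
    exact hτ X), fun η' hη' => ExtExactFunctor.Hom.ext ?_⟩
  · obtain ⟨Z, A, c, a, δ, he⟩ := exists_rep_loc e
    apply T'.pull_injective (P.F.map c.hom)
    have hη : T'.push _ (τ.app (S.Q.obj A)) (P.φ _ _ (T.mu S Z A δ)) =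
        T'.pull (τ.app (S.Q.obj Z)) _ (R.φ _ _ (T.mu S Z A δ)) := by
      rw [hτ, hτ]
      exact η.compat δ
    rw [← push_pull, ← P.φ_pull, ← he, P.φ_push, ← push_comp, τ.naturality, push_comp, hη,
      push_pull, ← R.φ_push, he, R.φ_pull, ← pull_comp, ← pull_comp, τ.naturality]
  · ext X
    obtain ⟨X, rfl⟩ := S.Q_obj_surjective X
    rw [hτ]
    exact NatTrans.congr_app (congrArg ExtExactFunctor.Hom.η hη') X

end UniversalProperty

end ExtTriple

/-! ### Inflations and deflations of the localization -/

namespace CategoryTheory.MorphismProperty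

variable {C : Type u} [Category.{v} C] (S : MorphismProperty C)

/-- As `S` need not be saturated, the denominator `k` is only inverted by `Q`; the point is that
the numerator can be chosen in `S`. -/
lemma exists_leftFraction_of_iso_Q [S.HasLeftCalculusOfFractions] {X Y : C}
    (θ : S.Q.obj X ≅ S.Q.obj Y) :
    ∃ (M : C) (s : X ⟶ M) (k : Y ⟶ M), S s ∧ IsIso (S.Q.map k) ∧
      θ.hom ≫ S.Q.map k = S.Q.map s := by
  obtain ⟨N, β, r, hr, hβ⟩ := S.exists_leftFraction_Q θ.hom
  have := Localization.inverts S.Q S _ hr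
  have : IsIso (S.Q.map β) := hβ ▸ inferInstance
  obtain ⟨M, c, t, ht, hc⟩ := S.exists_leftFraction_Q (inv (S.Q.map β))
  obtain ⟨M', t', ht', fac⟩ := (map_eq_iff_postcomp S.Q S t (β ≫ c)).1 (by
    rw [S.Q.map_comp, ← hc, IsIso.hom_inv_id_assoc])
  have hs : S (t ≫ t') := S.comp_mem _ _ ht ht'
  have := Localization.inverts S.Q S _ hs
  have h : θ.hom ≫ S.Q.map (r ≫ c ≫ t') = S.Q.map (t ≫ t') := by
    rw [S.Q.map_comp, reassoc_of% hβ, ← S.Q.map_comp, fac, Category.assoc]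
  refine ⟨M', t ≫ t', r ≫ c ≫ t', hs, ?_, h⟩
  rw [← Iso.eq_inv_comp] at h
  exact h ▸ inferInstance

lemma exists_rightFraction_of_iso_Q [S.HasRightCalculusOfFractions] {X Y : C}
    (θ : S.Q.obj X ≅ S.Q.obj Y) :
    ∃ (M : C) (k : M ⟶ X) (s : M ⟶ Y), S s ∧ IsIso (S.Q.map k) ∧
      S.Q.map k ≫ θ.hom = S.Q.map s := by
  obtain ⟨N, r, β, hr, hβ⟩ := S.exists_rightFraction_Q θ.hom
  have := Localization.inverts S.Q S _ hr
  have : IsIso (S.Q.map β) := hβ ▸ inferInstance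
  obtain ⟨M, t, c, ht, hc⟩ := S.exists_rightFraction_Q (inv (S.Q.map β))
  obtain ⟨M', t', ht', fac⟩ := (map_eq_iff_precomp S.Q S t (c ≫ β)).1 (by
    rw [S.Q.map_comp, ← hc, Category.assoc, IsIso.inv_hom_id, Category.comp_id])
  have hs : S (t' ≫ t) := S.comp_mem _ _ ht' ht
  have := Localization.inverts S.Q S _ hs
  have h : S.Q.map (t' ≫ c ≫ r) ≫ θ.hom = S.Q.map (t' ≫ t) := by
    rw [S.Q.map_comp, S.Q.map_comp, Category.assoc, Category.assoc, hβ, ← S.Q.map_comp,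
      ← S.Q.map_comp, fac]
  refine ⟨M', t' ≫ c ≫ r, t' ≫ t, hs, ?_, h⟩
  rw [← Iso.eq_comp_inv] at h
  exact h ▸ inferInstance

end CategoryTheory.MorphismProperty

namespace ExtTriple

variable {C : Type u} [Category.{v} C] [Preadditive C] [HasZeroObject C] [HasBinaryBiproducts C]
  {T : ExtTriple.{w} C} {S : MorphismProperty C}
  [S.HasLeftCalculusOfFractions] [S.HasRightCalculusOfFractions]

/-- The inflations of the localization are the morphisms isomorphic to images of inflations. -/
lemma inflations_loc_iff (hT : T.IsWeaklyExtriangulated) (hS : T.LiftsToTriangles S)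
    {X Y : S.Localization} (f : X ⟶ Y) :
    (T.loc S).inflations f ↔ ∃ (A B : C) (x : A ⟶ B) (a : S.Q.obj A ≅ X) (b : S.Q.obj B ≅ Y),
      T.inflations x ∧ S.Q.map x ≫ b.hom = a.hom ≫ f := by
  constructor
  · rintro ⟨Z, y, e, h⟩
    obtain ⟨A, B, Z₀, x₀, y₀, δ, a, b, c, h₀, hx, -⟩ := h.exists_iso_map_Q hT hS
    exact ⟨A, B, x₀, a, b, ⟨Z₀, y₀, δ, h₀⟩, hx⟩
  · rintro ⟨A, B, x, a, b, ⟨Z, y, δ, h⟩, hx⟩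
    exact ⟨_, b.inv ≫ S.Q.map y, (T.loc S).push _ a.hom (T.mu S Z A δ),
      (h.map_Q hT hS).loc_of_iso hT hS a b (Iso.refl _) ⟨hx, by simp, (pull_id _ _ _ _).symm⟩⟩

/-- The deflations of the localization are the morphisms isomorphic to images of deflations. -/
lemma deflations_loc_iff (hT : T.IsWeaklyExtriangulated) (hS : T.LiftsToTriangles S)
    {X Y : S.Localization} (f : X ⟶ Y) :
    (T.loc S).deflations f ↔ ∃ (A B : C) (y : A ⟶ B) (a : S.Q.obj A ≅ X) (b : S.Q.obj B ≅ Y),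
      T.deflations y ∧ S.Q.map y ≫ b.hom = a.hom ≫ f := by
  constructor
  · rintro ⟨A, x, e, h⟩
    obtain ⟨A₀, B, Z₀, x₀, y₀, δ, a, b, c, h₀, -, hy, -⟩ := h.exists_iso_map_Q hT hS
    exact ⟨B, Z₀, y₀, b, c, ⟨A₀, x₀, δ, h₀⟩, hy⟩
  · rintro ⟨B, Z, y, b, c, ⟨A, x, δ, h⟩, hy⟩
    refine ⟨_, S.Q.map x ≫ b.hom, (T.loc S).pull c.inv _ (T.mu S Z A δ),
      (h.map_Q hT hS).loc_of_iso hT hS (Iso.refl _) b c ⟨by simp, hy, ?_⟩⟩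
    rw [← pull_comp, c.hom_inv_id, pull_id]
    exact push_id _ _ _ _

/-- The isomorphism in the middle of a composite of two inflations of the localization is written
as a fraction with numerator in `S`. Its denominator is moved into the second inflation by pushing
out along it, so that the composite becomes the image of a composite of two sandwiches. -/
lemma inflations_loc_isStableUnderComposition (hT : T.IsWeaklyExtriangulated)
    (hS : T.LiftsToTriangles S) (h : (S.sandwich T.inflations).IsStableUnderComposition) :
    (T.loc S).inflations.IsStableUnderComposition where
  comp_mem f g hf hg := by
    rw [inflations_loc_iff hT hS] at hf hg ⊢
    obtain ⟨A, B, x, a, b, hx, hf⟩ := hf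
    obtain ⟨A', B', x', a', b', ⟨Z, y', δ, hδ⟩, hg⟩ := hg
    obtain ⟨M, s, k, hs, hk, hsk⟩ := S.exists_leftFraction_of_iso_Q (b ≪≫ a'.symm)
    obtain ⟨B'', x'', y'', h''⟩ := exists_isTriangle (T.push Z k δ)
    obtain ⟨β, hβ, -⟩ := (hδ.map_Q hT hS).loc_exists_iso hT hS (h''.map_Q hT hS)
      (asIso (S.Q.map k)) (Iso.refl _) ((mu_push T S Z k δ).symm.trans (pull_id _ _ _ _).symm)
    obtain ⟨A₃, B₃, s₃, x₃, t₃, hs₃, hx₃, ht₃, fac⟩ := h.comp_mem x (s ≫ x'')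
      ⟨_, _, 𝟙 _, x, 𝟙 _, S.id_mem _, hx, S.id_mem _, by simp⟩
      ⟨_, _, s, x'', 𝟙 _, hs, ⟨_, _, _, h''⟩, S.id_mem _, by simp⟩
    have := Localization.inverts S.Q S _ hs₃
    have := Localization.inverts S.Q S _ ht₃
    refine ⟨A₃, B₃, x₃, (asIso (S.Q.map s₃)).symm ≪≫ a, asIso (S.Q.map t₃) ≪≫ β.symm ≪≫ b', hx₃,
      ?_⟩
    rw [← cancel_epi (S.Q.map s₃)]
    have fac' := congrArg S.Q.map fac
    simp only [S.Q.map_comp, ← hsk] at fac'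
    simp only [Iso.trans_hom, Iso.symm_hom, asIso_hom, asIso_inv, Category.assoc,
      IsIso.hom_inv_id_assoc] at fac' hβ ⊢
    rw [← reassoc_of% fac', ← reassoc_of% hβ, β.hom_inv_id_assoc, hg, a'.inv_hom_id_assoc,
      reassoc_of% hf]

lemma deflations_loc_isStableUnderComposition (hT : T.IsWeaklyExtriangulated)
    (hS : T.LiftsToTriangles S) (h : (S.sandwich T.deflations).IsStableUnderComposition) :
    (T.loc S).deflations.IsStableUnderComposition where
  comp_mem f g hf hg := by
    rw [deflations_loc_iff hT hS] at hf hg ⊢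
    obtain ⟨A, B, y, a, b, ⟨K, x, δ, hδ⟩, hf⟩ := hf
    obtain ⟨A', B', y', a', b', hy', hg⟩ := hg
    obtain ⟨M, k, s, hs, hk, hsk⟩ := S.exists_rightFraction_of_iso_Q (b ≪≫ a'.symm)
    obtain ⟨B'', x'', y'', h''⟩ := exists_isTriangle (T.pull k K δ)
    obtain ⟨β, -, hβ, -⟩ := (h''.map_Q hT hS).loc_exists_iso hT hS (hδ.map_Q hT hS)
      (Iso.refl _) (asIso (S.Q.map k)) ((push_id _ _ _ _).trans (mu_pull T S k K δ))
    obtain ⟨A₃, B₃, s₃, y₃, t₃, hs₃, hy₃, ht₃, fac⟩ := h.comp_mem (y'' ≫ s) y'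
      ⟨_, _, 𝟙 _, y'', s, S.id_mem _, ⟨_, _, _, h''⟩, hs, by simp⟩
      ⟨_, _, 𝟙 _, y', 𝟙 _, S.id_mem _, hy', S.id_mem _, by simp⟩
    have := Localization.inverts S.Q S _ hs₃
    have := Localization.inverts S.Q S _ ht₃
    refine ⟨A₃, B₃, y₃, (asIso (S.Q.map s₃)).symm ≪≫ β ≪≫ a, asIso (S.Q.map t₃) ≪≫ b', hy₃, ?_⟩
    rw [← cancel_epi (S.Q.map s₃)]
    have fac' := congrArg S.Q.map fac
    simp only [S.Q.map_comp, ← hsk] at fac'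
    simp only [Iso.trans_hom, Iso.symm_hom, asIso_hom, asIso_inv, Category.assoc,
      IsIso.hom_inv_id_assoc] at fac' hβ ⊢
    rw [← reassoc_of% fac', reassoc_of% hβ, reassoc_of% hf, hg, a'.inv_hom_id_assoc]

end ExtTriple

theorem corollary3p3
    {C : Type u} [Category.{v} C] [Preadditive C] [HasZeroObject C] [HasBinaryBiproducts C]
    (T : ExtTriple.{w} C) (hT : T.IsExtriangulated)
    (S : MorphismProperty C)
    -- `S` contains the isomorphisms, is closed by composition and by finite direct sums
    (hS_iso : MorphismProperty.isomorphisms C ≤ S)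
    (hS_comp : S.IsStableUnderComposition)
    (hS_sum : ∀ {X₁ X₂ Y₁ Y₂ : C} (f₁ : X₁ ⟶ Y₁) (f₂ : X₂ ⟶ Y₂), S f₁ → S f₂ →
      S (biprod.map f₁ f₂))
    -- the image of `S` in the ideal quotient is closed by compositions with isomorphisms
    (hS_bar : S.strictMap S.idealQuotientFunctor = (S.strictMap S.idealQuotientFunctor).isoClosure)
    -- 2-out-of-3
    (hM1 : S.HasTwoOutOfThreeProperty)
    -- `S` is a multiplicative system
    [S.HasLeftCalculusOfFractions] [S.HasRightCalculusOfFractions]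
    -- extensions of morphisms in `S` to morphisms of triangles by morphisms in `S`
    (hM3 : ∀ {A B Z A' B' Z' : C} (x : A ⟶ B) (y : B ⟶ Z) (δ : T.Ext Z A)
      (x' : A' ⟶ B') (y' : B' ⟶ Z') (δ' : T.Ext Z' A') (a : A ⟶ A') (c : Z ⟶ Z'),
      T.IsTriangle x y δ → T.IsTriangle x' y' δ' → T.push Z a δ = T.pull c A' δ' →
      S a → S c → ∃ b : B ⟶ B', S b ∧ T.IsTriangleHom x y δ x' y' δ' a b c) :
    -- the localization is an additive category, with a triple and an exact functor `(Q, μ)`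
    ∃ (_ : HasBinaryBiproducts S.Localization) (TL : ExtTriple.{max u v w} S.Localization)
      (Qμ : ExtExactFunctor T TL),
      -- weak extriangulation on the strict localization `Q`
      TL.IsWeaklyExtriangulated ∧ Qμ.F = S.Q ∧
      -- universality
      (∀ (D : Type u') [Category.{v'} D] [Preadditive D] [HasZeroObject D] [HasBinaryBiproducts D]
        (T' : ExtTriple.{w'} D), T'.IsWeaklyExtriangulated →
        (∀ P : ExtExactFunctor T T', S.IsInvertedBy P.F →
          ∃! P' : ExtExactFunctor TL T', Qμ.comp P' = P) ∧
        -- by the previous clause, the exact functors inverting `S` are the `Qμ.comp P'`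
        (∀ (P' R' : ExtExactFunctor TL T') (η : (Qμ.comp P').Hom (Qμ.comp R')),
          ∃! η' : P'.Hom R', ExtExactFunctor.Hom.whiskerLeft Qμ η' = η)) ∧
      -- extriangulated if the two classes `S ∘ inflation ∘ S` and `S ∘ deflation ∘ S` compose
      ((S.sandwich T.inflations).IsStableUnderComposition →
        (S.sandwich T.deflations).IsStableUnderComposition → TL.IsExtriangulated) := by

  have hT' := hT.toIsWeaklyExtriangulated
  have hS : T.LiftsToTriangles S := fun _ _ _ _ _ _ => hM3
  have := ExtTriple.hasBinaryBiproducts_localization S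
  refine ⟨this, T.loc S, ExtTriple.toLoc hT' hS, ExtTriple.isWeaklyExtriangulated_loc hT' hS, rfl,
    fun D _ _ _ _ T' hD => ⟨fun P hP => ?_, fun P' R' η =>
      ExtTriple.existsUnique_whiskerLeft_toLoc hT' hS P' R' η⟩, fun hinf hdef =>
    { toIsWeaklyExtriangulated := ExtTriple.isWeaklyExtriangulated_loc hT' hS
      c4 := ExtTriple.inflations_loc_isStableUnderComposition hT' hS hinf
      c4' := ExtTriple.deflations_loc_isStableUnderComposition hT' hS hdef }⟩
  obtain ⟨P', hP'⟩ := ExtTriple.exists_toLoc_comp_eq hT' hS hD P hP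
  exact ⟨P', hP', fun R' hR' => ExtTriple.toLoc_comp_injective hT' hS (hR'.trans hP'.symm)⟩
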